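/- **Setting.** Let $n,i\ge 0$. A finite simplicial complex $\Sigma$ on $[0,n]=\{0,\dots,n\}$ is a set of non-empty subsets of $[0,n]$ closed under passing to non-empty subsets; $\Sigma_p$ is the set of $\sigma\in\Sigma$ with $|\sigma|=p+1$. Let $C_\bullet(\Sigma)$ be the integral chain complex with basis $\Sigma$ and $\partial\{v_0<\dots<v_q\}=\sum_p(-1)^p\{v_0,\dots,\hat v_p,\dots,v_q\}$ (zero on vertices). On $C_\bullet(\Sigma)\otimes C_\bullet(\Sigma)$ put $\partial(x\otimes y)=\partial x\otimes y+(-1)^{|x|}x\otimes\partial y$ and $T(x\otimes y)=(-1)^{|x||y|}y\otimes x$. A set $U\subseteq\Sigma_{i+1}$ is *$\Sigma$-consistent* if for every $M\in\Sigma_{i+2}$ the set $\{M\setminus k: k\in M\}\cap U$ is a beginning or an ending segment of $\{M\setminus k:k\in M\}$ in the lexicographic order ($M\setminus k'<M\setminus k$ iff $k<k'$). For such $U$ and $\sigma\in\Sigma$ put $$\Delta_i^U(\sigma)=\sum_{L\subseteq\sigma,\ |L|=i+1}(-1)^{\varepsilon_L}\,(L\cup A_L)\otimes(L\cup B_L),$$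 where $A_L$ consists of those $a\in\sigma\setminus L$ such that either $L\cup\{a\}\in U$ and $|\{l\in L:l>a\}|$ is even, or $L\cup\{a\}\notin U$ and $|\{l\in L:l>a\}|$ is odd; $B_L=\sigma\setminus(L\cup A_L)$; and $\varepsilon_L=\sum_{b\in B_L}|\{a\in A_L:a<b\}|+\sum_{l\in L}|\{l'\in L:l'<l\}|+|\sigma||A_L|$. Extend $\Delta_i^U$ linearly to $C_\bullet(\Sigma)$, and put $\Delta_{-1}^\emptyset=0$. A *solution* is a linear map $\Delta\colon C_\bullet(\Sigma)\to C_\bullet(\Sigma)\otimes C_\bullet(\Sigma)$ such that $$\partial\circ\Delta-(-1)^i\,\Delta\circ\partial=(1+(-1)^iT)\,\Delta_{i-1}^\emptyset .\tag{$*$}$$ It is *normalised* if $i>0$, or $i=0$ and $\Delta(\sigma)=\sigma\otimes\sigma$ for all $\sigma\in\Sigma_0$; it is *local* if for every $\sigma\in\Sigma$ only terms $X\otimes Y$ with $X,Y\subseteq\sigma$ occur in $\Delta(\sigma)$. The number of terms of $\Delta(\sigma)$ is the number of basis elements $X\otimes Y$ ($X,Y\in\Sigma$) with non-zero coefficient.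 **Theorem 4.5.** 1. For every $\Sigma$-consistent $U\subseteq\Sigma_{i+1}$, the map $\Delta_i^U$ satisfies $(*)$. 2. Let $\Delta'$ be a normalised solution (not assumed local) such that, for every $\sigma\in\Sigma$, $\Delta'(\sigma)$ has at most as many terms as $\Delta''(\sigma)$ for every local normalised solution $\Delta''$. Then $\Delta'=\Delta_i^U$ for some $\Sigma$-consistent $U\subseteq\Sigma_{i+1}$. 3. The same conclusion holds if $\Delta'$ is a local normalised solution whose total number of terms, summed over all $\sigma\in\Sigma$, is minimal among local normalised solutions. -/

import Mathlib

noncomputable section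

namespace CupCoproduct

open scoped TensorProduct

variable {V : Type*} [LinearOrder V]

/-! ### Chains on a simplicial complex

A simplicial complex is a set of non-empty finite sets of vertices closed under passing to
non-empty subsets; not every vertex has to be a simplex. -/

/-- The chains on `K` with integer coefficients: all degrees together, with the simplices of `K`
as basis. -/
abbrev Chains (K : PreAbstractSimplicialComplex V) : Type _ := K.faces →₀ ℤ

/-- The dimension of a simplex. -/
def dim {K : PreAbstractSimplicialComplex V} (σ : K.faces) : ℕ := σ.1.card - 1

open Classical in
/-- The basis chain of a finite set of vertices; it is zero if the set is not a simplex of `K`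
(in particular if it is empty). -/
def chain (K : PreAbstractSimplicialComplex V) (s : Finset V) : Chains K :=
  if h : s ∈ K.faces then Finsupp.single ⟨s, h⟩ 1 else 0

/-- The boundary: the alternating sum of the faces obtained by removing one vertex. The sign
exponent is the position of the removed vertex, and the boundary of a vertex is zero. -/
def boundary (K : PreAbstractSimplicialComplex V) : Chains K →ₗ[ℤ] Chains K :=
  Finsupp.linearCombination ℤ fun σ : K.faces =>
    ∑ v ∈ σ.1, (-1 : ℤ) ^ (σ.1.filter (· < v)).card • chain K (σ.1.erase v)

/-- The grading involution `x ↦ (-1) ^ |x| x`. -/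
def signMap (K : PreAbstractSimplicialComplex V) : Chains K →ₗ[ℤ] Chains K :=
  Finsupp.linearCombination ℤ fun σ : K.faces => (-1 : ℤ) ^ dim σ • Finsupp.single σ (1 : ℤ)

/-- The boundary of the tensor square, `∂ (x ⊗ y) = ∂ x ⊗ y + (-1) ^ |x| x ⊗ ∂ y`. -/
def tensorBoundary (K : PreAbstractSimplicialComplex V) :
    Chains K ⊗[ℤ] Chains K →ₗ[ℤ] Chains K ⊗[ℤ] Chains K :=
  TensorProduct.map (boundary K) LinearMap.id + TensorProduct.map (signMap K) (boundary K)

/-- The symmetry `T (x ⊗ y) = (-1) ^ (|x| |y|) y ⊗ x`. -/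
def swap (K : PreAbstractSimplicialComplex V) :
    Chains K ⊗[ℤ] Chains K →ₗ[ℤ] Chains K ⊗[ℤ] Chains K :=
  TensorProduct.lift <|
    Finsupp.linearCombination ℤ fun σ : K.faces =>
      Finsupp.linearCombination ℤ fun τ : K.faces =>
        (-1 : ℤ) ^ (dim σ * dim τ) •
          ((Finsupp.single τ (1 : ℤ) : Chains K) ⊗ₜ[ℤ] (Finsupp.single σ (1 : ℤ) : Chains K))

/-! ### Consistent sets -/

/-- The intersection of `U` with the packet `{M \ k | k ∈ M}` is a beginning segment or an ending
segment of the packet in the lexicographic order, in which `M \ k'` comes before `M \ k` if and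
only if `k < k'`. -/
def ConsistentAt (U : Set (Finset V)) (M : Finset V) : Prop :=
  (∀ k ∈ M, ∀ k' ∈ M, k < k' → M.erase k ∈ U → M.erase k' ∈ U) ∨
    (∀ k ∈ M, ∀ k' ∈ M, k < k' → M.erase k' ∈ U → M.erase k ∈ U)

/-- `U` is a set of `(i + 1)`-simplices of `K` that is consistent with respect to all
`(i + 2)`-simplices of `K`. -/
def IsConsistent (K : PreAbstractSimplicialComplex V) (i : ℕ) (U : Set (Finset V)) : Prop :=
  (∀ s ∈ U, s ∈ K.faces ∧ s.card = i + 2) ∧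
    ∀ M ∈ K.faces, M.card = i + 3 → ConsistentAt U M

/-! ### The coproduct of a set `U` -/

/-- `U_σ`: the elements of `U` that are `(i + 2)`-element subsets of `σ`. -/
def restrict (i : ℕ) (U : Set (Finset V)) (σ : Finset V) : Set (Finset V) :=
  {s | s ∈ U ∧ s ⊆ σ ∧ s.card = i + 2}

/-- `a` is an even gap in `L`: the number of elements of `L` above `a` is even. -/
def EvenGap (L : Finset V) (a : V) : Prop := Even (L.filter (a < ·)).card

open Classical in
/-- `A_L`: the initial vertex of the cube with generating vectors `L` in the cubillage of the
cyclic zonotope on `σ` with inversion set `U`. -/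
def initVertex (U : Set (Finset V)) (σ L : Finset V) : Finset V :=
  (σ \ L).filter fun a =>
    (insert a L ∈ U ∧ EvenGap L a) ∨ (insert a L ∉ U ∧ ¬ EvenGap L a)

/-- `B_L`: the elements of `σ` that are neither in `L` nor in `A_L`. -/
def coVertex (U : Set (Finset V)) (σ L : Finset V) : Finset V :=
  σ \ (L ∪ initVertex U σ L)

/-- The sign exponent of `(L ∪ A) ⊗ (L ∪ B)` on a simplex with `m` vertices. -/
def signExp (m : ℕ) (L A B : Finset V) : ℕ :=
  ∑ b ∈ B, (A.filter (· < b)).card + ∑ l ∈ L, (L.filter (· < l)).card + m * A.card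

/-- The value on the simplex `σ` of the coproduct with inversion set `U`: the signed sum of
`(L ∪ A_L) ⊗ (L ∪ B_L)` over the `(i + 1)`-element subsets `L` of `σ`. -/
def simplexCoproduct (K : PreAbstractSimplicialComplex V) (i : ℕ) (U : Set (Finset V))
    (σ : Finset V) : Chains K ⊗[ℤ] Chains K :=
  ∑ L ∈ σ.powersetCard (i + 1),
    (-1 : ℤ) ^ signExp σ.card L (initVertex U σ L) (coVertex U σ L) •
      (chain K (L ∪ initVertex U σ L) ⊗ₜ[ℤ] chain K (L ∪ coVertex U σ L))

/-- The simplexwise coproduct `Δ_i^U` on the chains of `K`. -/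
def coproduct (K : PreAbstractSimplicialComplex V) (i : ℕ) (U : Set (Finset V)) :
    Chains K →ₗ[ℤ] Chains K ⊗[ℤ] Chains K :=
  Finsupp.linearCombination ℤ fun σ : K.faces => simplexCoproduct K i (restrict i U σ.1) σ.1

/-- `Δ_{i-1}^∅`, with the convention that it is zero for `i = 0`. -/
def prevCoproduct (K : PreAbstractSimplicialComplex V) :
    ℕ → (Chains K →ₗ[ℤ] Chains K ⊗[ℤ] Chains K)
  | 0 => 0
  | i + 1 => coproduct K i ∅

/-! ### The homotopy formula and the number of terms -/

/-- The homotopy formula `∂ Δ - (-1) ^ i Δ ∂ = (1 + (-1) ^ i T) Δ_{i-1}^∅`. -/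
def HomotopyFormula (K : PreAbstractSimplicialComplex V) (i : ℕ)
    (D : Chains K →ₗ[ℤ] Chains K ⊗[ℤ] Chains K) : Prop :=
  tensorBoundary K ∘ₗ D - (-1 : ℤ) ^ i • (D ∘ₗ boundary K) =
    (LinearMap.id + (-1 : ℤ) ^ i • swap K) ∘ₗ prevCoproduct K i

/-- For `i = 0`, every vertex `σ` is sent to `σ ⊗ σ`; no condition for `i > 0`. -/
def IsNormalized (K : PreAbstractSimplicialComplex V) (i : ℕ)
    (D : Chains K →ₗ[ℤ] Chains K ⊗[ℤ] Chains K) : Prop :=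
  i = 0 → ∀ σ : K.faces, dim σ = 0 →
    D (Finsupp.single σ 1) =
      (Finsupp.single σ (1 : ℤ) : Chains K) ⊗ₜ[ℤ] (Finsupp.single σ (1 : ℤ) : Chains K)

/-- The basis elements `X ⊗ Y` that occur with a non-zero coefficient. -/
def terms {K : PreAbstractSimplicialComplex V} (x : Chains K ⊗[ℤ] Chains K) :
    Finset (K.faces × K.faces) :=
  (finsuppTensorFinsupp' ℤ K.faces K.faces x).support

/-- The number of terms of `D σ`. -/
def numTerms {K : PreAbstractSimplicialComplex V}
    (D : Chains K →ₗ[ℤ] Chains K ⊗[ℤ] Chains K) (σ : K.faces) : ℕ :=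
  (terms (D (Finsupp.single σ 1))).card

/-- The terms of `D σ` involve only faces of `σ`. -/
def IsLocal {K : PreAbstractSimplicialComplex V}
    (D : Chains K →ₗ[ℤ] Chains K ⊗[ℤ] Chains K) : Prop :=
  ∀ σ : K.faces, ∀ p ∈ terms (D (Finsupp.single σ 1)), p.1.1 ⊆ σ.1 ∧ p.2.1 ⊆ σ.1

open Classical in
/-- The total number of terms of `D`, over all simplices. -/
def totalTerms [Fintype V] {K : PreAbstractSimplicialComplex V}
    (D : Chains K →ₗ[ℤ] Chains K ⊗[ℤ] Chains K) : ℕ :=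
  ∑ σ : K.faces, numTerms D σ

end CupCoproduct

end

/-! A term X ⊗ Y with X ∪ Y = σ is a cube in [0,1]^σ: the directions in L = X ∩ Y are free, the
coordinates in A = X \ Y equal 1, those in Y \ X equal 0. Removing x ∈ L from X or from Y passes to
one of the two facets in direction x, so up to signs the boundary of the tensor square is the
cubical boundary. If Δ is local, Δ∂ contributes nothing at X ⊗ Y with X ∪ Y = σ. For |L| = i the
homotopy formula then says that the signed sum of the coefficients of the cubes having the facet (L,
A) is the indicator of the initial facet minus that of the final (antipodal) facet; see
`coeffFormula_iff_cubeFormula`.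

Solutions from consistent sets: for |L| = i, the set U defines a relation `Precedes` on σ \ L, and
consistency of the packets L ∪ {x, y, z} makes it transitive, hence a linear order. Measured from
the initial facet, the cube of U in direction x starts at the set of predecessors of x, so its two
x-facets are the predecessors of x without and with x. The sum telescopes from ∅ to σ \ L
(`sum_predecessors`, `cubeFormula_model`). The remaining coefficients only need A_L to be compatible
with deleting a vertex from σ.

Lower bound: fix |L| = i + 1 and l ∈ L. Summing the cubical formula over the facets with directions
L \ l lying on the initial side in coordinate l cancels all directions but l, and shows that the
corrected coefficients of the cubes with directions L add up to 1 (`IsLocalSolution.sum_cubeCoeff`).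
So a local normalised solution has at least C(|σ|, i+1) terms on σ, and Δ_i^∅ attains this bound.

Converse: in the case of equality each L carries exactly one cube. Deleting vertices reduces its
initial vertex to the data on L ∪ {a}, which is a binary choice; these choices form U. On L ∪ {x, y,
z} the initial facet must lie in some cube, so one of x, y, z has no predecessor; a violation of
consistency would make the relation cyclic (`consistentAt_inversionSet`). For a solution not known
to be local, composing with the retractions onto σ that collapse the outside to a vertex w gives
local solutions, and counting terms for all w excludes terms outside σ (`terms_subset_of_card_le`).
-/

noncomputable section

set_option linter.unusedSectionVars false

namespace CupCoproduct

open scoped TensorProduct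

section

variable {V : Type*} [LinearOrder V]

/-! ### Counting and signs -/

/-- The number of elements of `s` below `x`. -/
def below (s : Finset V) (x : V) : ℕ := (s.filter (· < x)).card

/-- The number of elements of `s` above `x`. -/
def above (s : Finset V) (x : V) : ℕ := (s.filter (x < ·)).card

theorem below_add_above {s : Finset V} {x : V} (hx : x ∉ s) : below s x + above s x = s.card := by
  unfold below above
  rw [← Finset.card_filter_add_card_filter_not (s := s) (· < x)]
  congr 2
  ext y
  simp only [Finset.mem_filter, not_lt, and_congr_right_iff]
  intro hy
  exact ⟨le_of_lt, fun h => lt_of_le_of_ne h (by rintro rfl; exact hx hy)⟩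

theorem below_union {s t : Finset V} (h : Disjoint s t) (x : V) :
    below (s ∪ t) x = below s x + below t x := by
  unfold below
  rw [Finset.filter_union, Finset.card_union_of_disjoint]
  exact Finset.disjoint_filter_filter h

theorem below_insert_self (s : Finset V) (x : V) : below (insert x s) x = below s x := by
  simp [below, Finset.filter_insert]

theorem below_erase_self (s : Finset V) (x : V) : below (s.erase x) x = below s x := by
  simp [below, Finset.filter_erase]

theorem below_insert {s : Finset V} {x : V} (hx : x ∉ s) (y : V) :
    below (insert x s) y = below s y + if x < y then 1 else 0 := by
  unfold below
  rw [Finset.filter_insert]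
  split_ifs with h
  · rw [Finset.card_insert_of_notMem (by simp [hx])]
  · rfl

theorem above_insert {s : Finset V} {x : V} (hx : x ∉ s) (y : V) :
    above (insert x s) y = above s y + if y < x then 1 else 0 := by
  unfold above
  rw [Finset.filter_insert]
  split_ifs with h
  · rw [Finset.card_insert_of_notMem (by simp [hx])]
  · rfl

/-- The number of pairs `a < b` with `a ∈ A` and `b ∈ B`. -/
def ascents (A B : Finset V) : ℕ := ∑ b ∈ B, below A b

theorem ascents_eq_sum_above (A B : Finset V) : ascents A B = ∑ a ∈ A, above B a := by
  simp only [ascents, below, above, Finset.card_filter]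
  exact Finset.sum_comm

theorem ascents_insert_right {A B : Finset V} {x : V} (hx : x ∉ B) :
    ascents A (insert x B) = ascents A B + below A x := by
  rw [ascents, Finset.sum_insert hx, add_comm, ascents]

theorem ascents_insert_left {A B : Finset V} {x : V} (hx : x ∉ A) :
    ascents (insert x A) B = ascents A B + above B x := by
  rw [ascents_eq_sum_above, Finset.sum_insert hx, add_comm, ascents_eq_sum_above]

theorem ascents_add_ascents {A B : Finset V} (h : Disjoint A B) :
    ascents A B + ascents B A = A.card * B.card := by
  rw [ascents, ascents_eq_sum_above B A, ← Finset.sum_add_distrib]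
  rw [Finset.sum_congr rfl fun b hb =>
    below_add_above (Finset.disjoint_right.1 h hb)]
  simp [mul_comm]

theorem ascents_self_insert {L : Finset V} {x : V} (hx : x ∉ L) :
    ascents (insert x L) (insert x L) = ascents L L + L.card := by
  rw [ascents_insert_right hx, ascents_insert_left hx, below_insert_self, ← below_add_above hx]
  ring

theorem signExp_eq (m : ℕ) (L A B : Finset V) :
    signExp m L A B = ascents A B + ascents L L + m * A.card := rfl

theorem evenGap_iff (L : Finset V) (a : V) : EvenGap L a ↔ Even (above L a) := Iff.rfl

theorem neg_one_pow_congr {a b : ℕ} (h : Even a ↔ Even b) : (-1 : ℤ) ^ a = (-1) ^ b := by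
  by_cases hb : Even b
  · rw [hb.neg_one_pow, (h.2 hb).neg_one_pow]
  · rw [Odd.neg_one_pow (Nat.not_even_iff_odd.1 (mt h.1 hb)),
      Odd.neg_one_pow (Nat.not_even_iff_odd.1 hb)]

/-- The exponent `signExp` is chosen so that, once cubes and facets are normalised by it, the
boundary sign depends only on the number of elements of `L` above `x`. Here `x` leaves the first
factor and becomes a 0-coordinate. -/
theorem sign_remove_left {m : ℕ} {L A B : Finset V} {x : V} (hxL : x ∉ L)
    (hxB : x ∉ B) (hLA : Disjoint L A) :
    (-1 : ℤ) ^ below (L ∪ A) x * (-1) ^ signExp m (insert x L) A B =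
      (-1) ^ signExp m L A (insert x B) * (-1) ^ above L x := by
  rw [← pow_add, ← pow_add]
  apply neg_one_pow_congr
  rw [signExp_eq, signExp_eq, below_union hLA, ascents_self_insert hxL,
    ascents_insert_right hxB, ← below_add_above hxL]
  simp only [Nat.even_iff]
  omega

/-- The opposite facet, where `x` leaves the second factor and becomes a 1-coordinate. The
additional `+ 1` says that opposite facets of a cube occur with opposite signs. -/
theorem sign_remove_right {m : ℕ} {L A B : Finset V} {x : V} (hxL : x ∉ L) (hxA : x ∉ A)
    (hxB : x ∉ B) (hLB : Disjoint L B) (hm : m = L.card + A.card + B.card + 1) :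
    (-1 : ℤ) ^ (L.card + A.card) * (-1 : ℤ) ^ below (L ∪ B) x *
        (-1) ^ signExp m (insert x L) A B =
      (-1) ^ signExp m L (insert x A) B * (-1) ^ (above L x + 1) := by
  rw [← pow_add, ← pow_add, ← pow_add]
  apply neg_one_pow_congr
  rw [signExp_eq, signExp_eq, below_union hLB, ascents_self_insert hxL,
    ascents_insert_left hxA, Finset.card_insert_of_notMem hxA]
  have h1 := below_add_above hxL
  have h2 := below_add_above hxB
  rw [← h1, ← h2] at hm
  rw [← h1, mul_add, mul_one]
  simp only [Nat.even_iff]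
  omega

/-- The symmetry exchanges `A` and `B`, and its total sign after normalisation is always -1. This is
why the right-hand side of the homotopy formula becomes a difference of two indicators. The
positivity hypotheses make the truncated subtractions genuine dimensions. -/
theorem sign_swap {m i : ℕ} {L A B : Finset V} (hAB : Disjoint A B) 
    (hm : m = i + A.card + B.card) (hA : 0 < i + A.card) (hB : 0 < i + B.card) :
    (-1 : ℤ) ^ i * ((-1) ^ ((i + A.card - 1) * (i + B.card - 1)) * (-1) ^ signExp m L B A) =
      -(-1) ^ signExp m L A B := by
  rw [show (-(-1) ^ signExp m L A B : ℤ) = (-1) ^ (signExp m L A B + 1) by ring, ← pow_add,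
    ← pow_add]
  apply neg_one_pow_congr
  obtain ⟨a, ha⟩ := Nat.exists_eq_add_of_lt hA
  obtain ⟨b, hb⟩ := Nat.exists_eq_add_of_lt hB
  rw [signExp_eq, signExp_eq, show i + A.card - 1 = a by omega, show i + B.card - 1 = b by omega]
  have h1 := congrArg Even (ascents_add_ascents hAB)
  have h2 := congrArg Even ha
  have h3 := congrArg Even hb
  subst hm
  simp only [Nat.even_add, Nat.even_mul, Nat.even_add_one, zero_add,
    eq_iff_iff] at h1 h2 h3 ⊢
  generalize Even (ascents A B) = p1 at *
  generalize Even (ascents B A) = p2 at *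
  generalize Even (ascents L L) = p3 at *
  generalize Even A.card = p4 at *
  generalize Even B.card = p5 at *
  generalize Even a = p6 at *
  generalize Even b = p7 at *
  generalize Even i = p8 at *
  by_cases p1 <;> by_cases p2 <;> by_cases p4 <;> by_cases p5 <;> by_cases p8 <;> simp_all

end

section

variable {V : Type*} [LinearOrder V]

/-! ### The homotopy formula in coefficients -/

open Classical in
/-- The coefficient of `X ⊗ Y` in the value on `τ` of the coproduct with inversion set `U` whose
generating sets have `k` elements. -/
def model (k : ℕ) (U : Set (Finset V)) (τ X Y : Finset V) : ℤ :=
  if X ∪ Y = τ ∧ (X ∩ Y).card = k ∧ X \ Y = initVertex U τ (X ∩ Y) then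
    (-1) ^ signExp τ.card (X ∩ Y) (X \ Y) (Y \ X) else 0

/-- The homotopy formula on `τ` at the coefficient of `X ⊗ Y`, for a family `c` of coefficients. -/
def CoeffFormula [Fintype V] (c : Finset V → Finset V → Finset V → ℤ) (i : ℕ)
    (τ X Y : Finset V) : Prop :=
  ∑ x ∈ Xᶜ, (-1) ^ below X x * c τ (insert x X) Y +
      (-1) ^ (X.card - 1) * ∑ y ∈ Yᶜ, (-1) ^ below Y y * c τ X (insert y Y) -
      (-1) ^ i * ∑ w ∈ τ, (-1) ^ below τ w * c (τ.erase w) X Y =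
    model i ∅ τ X Y + (-1) ^ i * ((-1) ^ ((X.card - 1) * (Y.card - 1)) * model i ∅ τ Y X)

/-- The coefficient of the cube with generating vectors `L` and initial vertex `A`, corrected by
its sign. -/
def cubeCoeff (c : Finset V → Finset V → Finset V → ℤ) (σ L A : Finset V) : ℤ :=
  (-1) ^ signExp σ.card L A (σ \ (L ∪ A)) * c σ (L ∪ A) (σ \ A)

open Classical in
/-- The sign of the facet with initial vertex `A` of a cube in direction `x`. -/
def facetSign (L A : Finset V) (x : V) : ℤ := if x ∈ A ↔ EvenGap L x then -1 else 1

/-- The cubical form of the homotopy formula at the facet with generating vectors `L` and initial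
vertex `A`. -/
def CubeFormula (c : Finset V → Finset V → Finset V → ℤ) (σ L A : Finset V) : Prop :=
  ∑ x ∈ σ \ L, facetSign L A x * cubeCoeff c σ (insert x L) (A.erase x) =
    (if A = initVertex ∅ σ L then 1 else 0) - if σ \ (L ∪ A) = initVertex ∅ σ L then 1 else 0

theorem facetSign_of_notMem {L A : Finset V} {x : V} (hx : x ∉ A) :
    facetSign L A x = (-1) ^ above L x := by
  unfold facetSign
  rw [evenGap_iff]
  by_cases h : Even (above L x)
  · simp [h, hx]
  · simp [h, hx, (Nat.not_even_iff_odd.1 h).neg_one_pow]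

theorem facetSign_of_mem {L A : Finset V} {x : V} (hx : x ∈ A) :
    facetSign L A x = (-1) ^ (above L x + 1) := by
  unfold facetSign
  rw [evenGap_iff, pow_succ]
  by_cases h : Even (above L x)
  · simp [h, hx]
  · simp [h, hx, (Nat.not_even_iff_odd.1 h).neg_one_pow]

theorem neg_one_pow_mul_self (n : ℕ) : (-1 : ℤ) ^ n * (-1) ^ n = 1 := by
  rw [← mul_pow]; simp

theorem model_eq_of_disjoint {k : ℕ} {U : Set (Finset V)} {σ L A : Finset V} (hLσ : L ⊆ σ)
    (hA : A ⊆ σ \ L) (hL : L.card = k) :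
    model k U σ (L ∪ A) (σ \ A) =
      if A = initVertex U σ L then (-1) ^ signExp σ.card L A (σ \ (L ∪ A)) else 0 := by
  have hA' : ∀ a ∈ A, a ∈ σ ∧ a ∉ L := fun a ha => by simpa using hA ha
  have h1 : (L ∪ A) ∪ σ \ A = σ := by
    ext a; have := hA' a; have := @hLσ a; grind
  have h2 : (L ∪ A) ∩ (σ \ A) = L := by
    ext a; have := hA' a; have := @hLσ a; grind
  have h3 : (L ∪ A) \ (σ \ A) = A := by
    ext a; have := hA' a; have := @hLσ a; grind
  have h4 : (σ \ A) \ (L ∪ A) = σ \ (L ∪ A) := by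
    ext a; grind
  simp only [model, h1, h2, h3, h4, hL, true_and]

/-- Both sides of the coefficient formula are the facet's own sign times the corresponding sides of
the cubical one. Non-emptiness of both factors is needed because an empty factor is not a simplex;
it can fail only for `L = ∅`. -/
theorem coeffFormula_iff_cubeFormula [Fintype V] {c : Finset V → Finset V → Finset V → ℤ} {i : ℕ}
    {σ L A : Finset V} (hc : ∀ τ ⊆ σ, ∀ X Y, c τ X Y ≠ 0 → X ⊆ τ ∧ Y ⊆ τ) (hLσ : L ⊆ σ)
    (hL : L.card = i) (hA : A ⊆ σ \ L) (hX : (L ∪ A).Nonempty) (hY : (σ \ A).Nonempty) :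
    CoeffFormula c i σ (L ∪ A) (σ \ A) ↔ CubeFormula c σ L A := by
  have hA' : ∀ a ∈ A, a ∈ σ ∧ a ∉ L := fun a ha => by simpa using hA ha
  set B := σ \ (L ∪ A) with hB
  have hYB : σ \ A = L ∪ B := by
    ext a; have := hA' a; have := @hLσ a; grind
  have hLA : Disjoint L A := Finset.disjoint_right.2 fun a ha => (hA' a ha).2
  have hLB : Disjoint L B := Finset.disjoint_left.2 fun a ha hb => by
    rw [hB] at hb; simp [ha] at hb
  have hAB : Disjoint A B := Finset.disjoint_left.2 fun a ha hb => by
    rw [hB] at hb; simp [ha] at hb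
  have hm : σ.card = i + A.card + B.card := by
    rw [← hL, ← Finset.card_union_of_disjoint hLA, hB,
      Finset.card_sdiff_of_subset (Finset.union_subset hLσ fun a ha => (hA' a ha).1)]
    have := Finset.card_le_card (Finset.union_subset hLσ fun a ha => (hA' a ha).1)
    omega
  set e : ℤ := (-1) ^ signExp σ.card L A B with he
  -- A vertex outside `σ` cannot be added, by locality, so only the vertices of `B` remain; adding
  -- one to the first factor makes it a free direction.
  have hfirst : ∑ x ∈ (L ∪ A)ᶜ, (-1) ^ below (L ∪ A) x * c σ (insert x (L ∪ A)) (σ \ A) =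
      e * ∑ x ∈ B, facetSign L A x * cubeCoeff c σ (insert x L) (A.erase x) := by
    rw [Finset.mul_sum]
    symm
    apply Finset.sum_subset_zero_on_sdiff
    · intro x hx; rw [hB] at hx; simp at hx ⊢; tauto
    · intro x hx
      simp only [hB, Finset.mem_sdiff, Finset.mem_compl] at hx
      by_cases h0 : c σ (insert x (L ∪ A)) (σ \ A) = 0
      · simp [h0]
      · have := (hc σ subset_rfl _ _ h0).1 (Finset.mem_insert_self _ _)
        tauto
    · intro x hx
      have hxA : x ∉ A := Finset.disjoint_right.1 hAB hx
      have hxL : x ∉ L := Finset.disjoint_right.1 hLB hx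
      rw [facetSign_of_notMem hxA, Finset.erase_eq_of_notMem hxA, cubeCoeff,
        ← Finset.insert_union]
      have h1 := sign_remove_left (m := σ.card) (B := B.erase x) hxL
        (Finset.notMem_erase _ _) hLA
      rw [Finset.insert_erase hx, ← he] at h1
      have h2 : σ \ (insert x L ∪ A) = B.erase x := by
        rw [hB]; ext a; grind
      rw [h2, ← mul_assoc, ← mul_assoc, ← h1, mul_assoc ((-1 : ℤ) ^ below _ _),
        neg_one_pow_mul_self, mul_one]
  have hsecond : (-1) ^ ((L ∪ A).card - 1) *
        ∑ y ∈ (σ \ A)ᶜ, (-1) ^ below (σ \ A) y * c σ (L ∪ A) (insert y (σ \ A)) =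
      e * ∑ x ∈ A, facetSign L A x * cubeCoeff c σ (insert x L) (A.erase x) := by
    rw [Finset.mul_sum, Finset.mul_sum]
    symm
    apply Finset.sum_subset_zero_on_sdiff
    · intro x hx; simp [hx]
    · intro x hx
      simp only [Finset.mem_sdiff, Finset.mem_compl, not_and, not_not] at hx
      by_cases h0 : c σ (L ∪ A) (insert x (σ \ A)) = 0
      · simp [h0]
      · have := (hc σ subset_rfl _ _ h0).2 (Finset.mem_insert_self _ _)
        tauto
    · intro x hx
      have hxB : x ∉ B := Finset.disjoint_left.1 hAB hx
      have hxL : x ∉ L := (hA' x hx).2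
      have hxσ : x ∈ σ := (hA' x hx).1
      have hcard : A.card = (A.erase x).card + 1 := (Finset.card_erase_add_one hx).symm
      rw [facetSign_of_mem hx, cubeCoeff]
      have h1 := sign_remove_right (m := σ.card) (A := A.erase x) hxL
        (Finset.notMem_erase _ _) hxB hLB (by omega)
      rw [Finset.insert_erase hx, ← he, ← hYB] at h1
      have h2 : σ \ (insert x L ∪ A.erase x) = B := by
        rw [hB]; ext a; grind
      have h3 : insert x L ∪ A.erase x = L ∪ A := by ext a; grind
      have h4 : σ \ A.erase x = insert x (σ \ A) := by ext a; grind
      have h5 : (L ∪ A).card - 1 = L.card + (A.erase x).card := by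
        rw [Finset.card_union_of_disjoint hLA]; omega
      rw [h2, h3, h4, h5, ← mul_assoc, ← mul_assoc, ← h1]
      linear_combination ((-1) ^ (L.card + (A.erase x).card) * (-1) ^ below (σ \ A) x *
        c σ (L ∪ A) (insert x (σ \ A))) *
        neg_one_pow_mul_self (signExp σ.card (insert x L) (A.erase x) B)
  -- A face of `σ` missing `w` cannot contain both factors, whose union is all of `σ`.
  have hthird : ∑ w ∈ σ, (-1) ^ below σ w * c (σ.erase w) (L ∪ A) (σ \ A) = 0 := by
    apply Finset.sum_eq_zero
    intro w hw
    by_cases h0 : c (σ.erase w) (L ∪ A) (σ \ A) = 0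
    · simp [h0]
    · have := hc _ (Finset.erase_subset _ _) _ _ h0
      by_cases hwA : w ∈ A
      · exact absurd (this.1 (Finset.mem_union_right _ hwA)) (by simp)
      · exact absurd (this.2 (Finset.mem_sdiff.2 ⟨hw, hwA⟩)) (by simp)
  have hm1 : model i ∅ σ (L ∪ A) (σ \ A) = e * if A = initVertex ∅ σ L then 1 else 0 := by
    rw [model_eq_of_disjoint hLσ hA hL]; simp [he, hB]
  have hm2 : (-1) ^ i * ((-1) ^ (((L ∪ A).card - 1) * ((σ \ A).card - 1)) *
      model i ∅ σ (σ \ A) (L ∪ A)) = -(e * if B = initVertex ∅ σ L then 1 else 0) := by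
    have h1 : L ∪ A = σ \ B := by
      rw [hB]; ext a; have := hA' a; have := @hLσ a; grind
    have h2 : σ \ (L ∪ B) = A := by
      rw [hB]; ext a; have := hA' a; have := @hLσ a; grind
    have hX' := Finset.card_pos.2 hX
    have hY' := Finset.card_pos.2 hY
    have h3 : (L ∪ A).card = i + A.card := by rw [Finset.card_union_of_disjoint hLA, hL]
    have h4 : (σ \ A).card = i + B.card := by rw [hYB, Finset.card_union_of_disjoint hLB, hL]
    rw [h3] at hX'
    rw [h4] at hY'
    rw [h3, h4, h1, hYB, model_eq_of_disjoint hLσ (by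
      rw [hB]; intro a; grind) hL, h2]
    split_ifs with h
    · rw [sign_swap hAB hm hX' hY', he, mul_one]
    · simp
  have hS : σ \ L = B ∪ A := by
    rw [hB]; ext a; have := hA' a; grind
  rw [CoeffFormula, CubeFormula, hfirst, hsecond, hthird, hm1, hm2, ← hB, hS,
    Finset.sum_union hAB.symm, mul_zero, sub_zero, ← mul_add, ← sub_eq_add_neg, ← mul_sub]
  exact mul_right_inj' (pow_ne_zero _ (by norm_num))

end

section

variable {V : Type*} [LinearOrder V]

/-! ### Consistent sets satisfy the homotopy formula -/

open Classical in
/-- Along a strict linear order on `S`, the signed count of the elements `x` such that `χ` is the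
set of predecessors of `x`, with or without `x` itself, telescopes. -/
theorem sum_predecessors {α : Type*} [DecidableEq α] (r : α → α → Prop) (S : Finset α)
    (hirr : ∀ x ∈ S, ¬ r x x) (htot : ∀ x ∈ S, ∀ y ∈ S, x ≠ y → (r x y ↔ ¬ r y x))
    (htrans : ∀ x ∈ S, ∀ y ∈ S, ∀ z ∈ S, r x y → r y z → r x z) (χ : Finset α) (hχ : χ ⊆ S) :
    ∑ x ∈ S, (if x ∈ χ then (-1 : ℤ) else 1) *
        (if χ.erase x = S.filter (r · x) then 1 else 0) =
      (if χ = ∅ then 1 else 0) - if χ = S then 1 else 0 := by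
  induction S using Finset.strongInduction generalizing χ with
  | H S ih =>
  rcases S.eq_empty_or_nonempty with rfl | hS
  · simp [Finset.subset_empty.1 hχ]
  -- An element with the most predecessors is the last one in the order.
  obtain ⟨m, hm, hmax⟩ := Finset.exists_max_image S (fun x => (S.filter (r · x)).card) hS
  have hlast : ∀ x ∈ S, x ≠ m → r x m := by
    intro x hx hxm
    by_contra h
    have hr : r m x := by rw [htot m hm x hx hxm.symm]; exact h
    have hlt : S.filter (r · m) ⊂ S.filter (r · x) := by
      rw [Finset.ssubset_iff]
      refine ⟨m, by simp [hirr m hm], ?_⟩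
      intro y hy
      rcases Finset.mem_insert.1 hy with rfl | hy
      · simp [hm, hr]
      · simp only [Finset.mem_filter] at hy ⊢
        exact ⟨hy.1, htrans y hy.1 m hm x hx hy.2 hr⟩
    exact absurd (hmax x hx) (not_le.2 (Finset.card_lt_card hlt))
  have hnot : ∀ x ∈ S, ¬ r m x := by
    intro x hx
    by_cases hxm : x = m
    · subst hxm; exact hirr x hx
    · rw [htot m hm x hx (Ne.symm hxm), not_not]; exact hlast x hx hxm
  have hmS : S.filter (r · m) = S.erase m := by
    ext y
    simp only [Finset.mem_filter, Finset.mem_erase]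
    constructor
    · rintro ⟨hy, hr⟩
      exact ⟨by rintro rfl; exact hirr y hy hr, hy⟩
    · rintro ⟨hym, hy⟩
      exact ⟨hy, hlast y hy hym⟩
  have hpred : ∀ x, x ∈ S → S.filter (r · x) = (S.erase m).filter (r · x) := by
    intro x hx
    ext y
    simp only [Finset.mem_filter, Finset.mem_erase]
    constructor
    · rintro ⟨hy, hr⟩
      exact ⟨⟨by rintro rfl; exact hnot x hx hr, hy⟩, hr⟩
    · rintro ⟨⟨_, hy⟩, hr⟩
      exact ⟨hy, hr⟩
  have hsub := Finset.erase_subset m S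
  rw [← Finset.add_sum_erase S _ hm, hmS]
  -- If `m ∈ χ`, no other element can contribute, since `m` precedes nothing. If `m ∉ χ`, the
  -- contribution of `m` is the indicator of `χ = S \ m`, which cancels the final term given by
  -- induction.
  by_cases hmχ : m ∈ χ
  · rw [Finset.sum_eq_zero, if_pos hmχ, if_neg (Finset.ne_empty_of_mem hmχ)]
    · have : χ.erase m = S.erase m ↔ χ = S := by
        constructor
        · intro h
          rw [← Finset.insert_erase hmχ, h, Finset.insert_erase hm]
        · rintro rfl; rfl
      by_cases h : χ = S <;> simp [this, h]
    · intro x hx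
      rw [Finset.mem_erase] at hx
      rw [if_neg (c := χ.erase x = _), mul_zero]
      intro h
      have : m ∈ χ.erase x := Finset.mem_erase.2 ⟨hx.1.symm, hmχ⟩
      rw [h, Finset.mem_filter] at this
      exact hnot x hx.2 this.2
  · have hχ' : χ ⊆ S.erase m := fun x hx =>
      Finset.mem_erase.2 ⟨by rintro rfl; exact hmχ hx, hχ hx⟩
    have hih := ih (S.erase m) (Finset.erase_ssubset hm) (fun x hx => hirr x (hsub hx))
      (fun x hx y hy => htot x (hsub hx) y (hsub hy))
      (fun x hx y hy z hz => htrans x (hsub hx) y (hsub hy) z (hsub hz)) χ hχ'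
    rw [Finset.sum_congr rfl fun x hx => by rw [hpred x (hsub hx)], hih, if_neg hmχ,
      Finset.erase_eq_of_notMem hmχ, if_neg (c := χ = S) (by rintro rfl; exact hmχ hm)]
    ring

/-- Compared in the linear order on the vertices outside `L` that is determined by `U`, the vertex
`y` precedes `x`. -/
def Precedes (U : Set (Finset V)) (L : Finset V) (y x : V) : Prop :=
  y ≠ x ∧ (insert y (insert x L) ∈ U ↔ x < y)

theorem precedes_iff_not {U : Set (Finset V)} {L : Finset V} {x y : V} (h : x ≠ y) :
    Precedes U L x y ↔ ¬ Precedes U L y x := by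
  unfold Precedes
  rw [Finset.insert_comm x y]
  rcases lt_or_gt_of_ne h with h' | h' <;> simp [h, h.symm, h', h'.not_gt]

/-- For a < b < c the set L ∪ {a, c} is the middle one of the three elements of the packet indexed
by a, b, c. A cyclic order would invert exactly {a, b} and {b, c}, or exactly {a, c}; neither is
compatible with a beginning or ending segment. -/
theorem precedes_trans_of_consistentAt {U : Set (Finset V)} {L : Finset V} {x y z : V}
    (hx : x ∉ L) (hy : y ∉ L) (hz : z ∉ L)
    (hU : x ≠ y → y ≠ z → x ≠ z → ConsistentAt U (insert x (insert y (insert z L))))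
    (h1 : Precedes U L x y) (h2 : Precedes U L y z) : Precedes U L x z := by
  -- Two opposite relations between the same elements are excluded by `precedes_iff_not`, so the
  -- three elements are distinct and consistency applies.
  have hxz : x ≠ z := by
    rintro rfl
    exact (precedes_iff_not h1.1).1 h1 h2
  have hU := hU h1.1 h2.1 hxz
  obtain ⟨hxy, h1⟩ := h1
  obtain ⟨hyz, h2⟩ := h2
  set M := insert x (insert y (insert z L)) with hM
  have ex : M.erase x = insert y (insert z L) := by rw [hM]; ext a; grind
  have ey : M.erase y = insert x (insert z L) := by rw [hM]; ext a; grind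
  have ez : M.erase z = insert x (insert y L) := by rw [hM]; ext a; grind
  have mx : x ∈ M := by simp [hM]
  have my : y ∈ M := by simp [hM]
  have mz : z ∈ M := by simp [hM]
  rw [← ez] at h1
  rw [← ex] at h2
  refine ⟨hxz, ?_⟩
  rw [← ey]
  rcases hU with hU | hU <;>
  · have a1 := hU x mx y my
    have a2 := hU y my x mx
    have a3 := hU x mx z mz
    have a4 := hU z mz x mx
    have a5 := hU y my z mz
    have a6 := hU z mz y my
    clear hU ex ey ez
    clear_value M
    rcases lt_or_gt_of_ne hxy with b1 | b1 <;> rcases lt_or_gt_of_ne hyz with b2 | b2 <;>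
      rcases lt_or_gt_of_ne hxz with b3 | b3 <;>
      first
        | exact absurd (b1.trans b2) b3.not_gt
        | exact absurd (b2.trans b1) b3.not_gt
        | simp only [b1, b2, b3, b1.not_gt, b2.not_gt, b3.not_gt, true_implies, false_implies,
            iff_true, iff_false] at *
          tauto

theorem mem_initVertex {U : Set (Finset V)} {σ L : Finset V} {a : V} :
    a ∈ initVertex U σ L ↔ (a ∈ σ ∧ a ∉ L) ∧ (insert a L ∈ U ↔ EvenGap L a) := by
  simp only [initVertex, Finset.mem_filter, Finset.mem_sdiff]
  tauto

theorem evenGap_insert {L : Finset V} {x y : V} (hx : x ∉ L) :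
    EvenGap (insert x L) y ↔ (EvenGap L y ↔ ¬ y < x) := by
  rw [evenGap_iff, evenGap_iff, above_insert hx, Nat.even_add]
  by_cases h : y < x <;> simp [h]

open Classical in
/-- The facet with initial vertex `A`, in coordinates in which the initial vertex of the cubillage
is the origin. -/
def facetCoord (σ L A : Finset V) : Finset V := (σ \ L).filter fun x => x ∈ A ↔ EvenGap L x

open Classical in
theorem facetCoord_eq_empty {σ L A : Finset V} (hA : A ⊆ σ \ L) :
    facetCoord σ L A = ∅ ↔ A = initVertex ∅ σ L := by
  rw [facetCoord, Finset.filter_eq_empty_iff, Finset.ext_iff]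
  refine forall_congr' fun a => ?_
  have := @hA a
  rw [mem_initVertex]
  simp only [Finset.mem_sdiff, Set.mem_empty_iff_false, false_iff] at this ⊢
  tauto

open Classical in
theorem facetCoord_eq_univ {σ L A : Finset V} :
    facetCoord σ L A = σ \ L ↔ σ \ (L ∪ A) = initVertex ∅ σ L := by
  rw [facetCoord, Finset.filter_eq_self, Finset.ext_iff]
  refine forall_congr' fun a => ?_
  rw [mem_initVertex]
  simp only [Finset.mem_sdiff, Finset.mem_union, Set.mem_empty_iff_false, false_iff]
  tauto

-- The geometric content of `Precedes`: in coordinates measured from the initial facet, the cube in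
-- direction `x` starts at the predecessors of `x`. Adding `x` to `L` changes the gap parity of `y`
-- exactly when `y < x`, which accounts for the comparison in the definition.
open Classical in
theorem erase_eq_initVertex_iff {U : Set (Finset V)} {σ L A : Finset V} (hA : A ⊆ σ \ L) {x : V}
    (hxL : x ∉ L) :
    A.erase x = initVertex U σ (insert x L) ↔
      (facetCoord σ L A).erase x = (σ \ L).filter (Precedes U L · x) := by
  rw [Finset.ext_iff, Finset.ext_iff]
  refine forall_congr' fun y => ?_
  have := @hA y
  simp only [mem_initVertex, evenGap_insert hxL, facetCoord, Finset.mem_erase, Finset.mem_filter,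
    Finset.mem_sdiff, Finset.mem_insert] at this ⊢
  unfold Precedes
  by_cases hyx : y = x
  · simp [hyx]
  · have h : ¬ y < x ↔ x < y := by
      rw [not_lt]; exact ⟨fun h => lt_of_le_of_ne h (Ne.symm hyx), le_of_lt⟩
    rw [h]
    generalize (insert y (insert x L) ∈ U) = u
    generalize (EvenGap L y) = e
    generalize (x < y) = l at *
    by_cases h1 : y ∈ A <;> by_cases h2 : e <;> by_cases h3 : u <;> simp_all

theorem cubeFormula_model {i : ℕ} {U : Set (Finset V)} {σ L A : Finset V}
    (hU : ∀ M ⊆ σ, M.card = i + 3 → ConsistentAt U M) (hLσ : L ⊆ σ) (hL : L.card = i)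
    (hA : A ⊆ σ \ L) : CubeFormula (model (i + 1) U) σ L A := by
  classical
  have hterm : ∀ x ∈ σ \ L, facetSign L A x *
      cubeCoeff (model (i + 1) U) σ (insert x L) (A.erase x) =
      (if x ∈ facetCoord σ L A then (-1 : ℤ) else 1) *
        (if (facetCoord σ L A).erase x = (σ \ L).filter (Precedes U L · x) then 1 else 0) := by
    intro x hx
    have hx' := Finset.mem_sdiff.1 hx
    rw [cubeCoeff, model_eq_of_disjoint (Finset.insert_subset hx'.1 hLσ) _
      (by rw [Finset.card_insert_of_notMem hx'.2, hL])]
    · congr 1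
      · simp [facetSign, facetCoord, hx'.1, hx'.2]
      · by_cases h : A.erase x = initVertex U σ (insert x L)
        · rw [if_pos h, if_pos ((erase_eq_initVertex_iff hA hx'.2).1 h), neg_one_pow_mul_self]
        · rw [if_neg h, if_neg (mt (erase_eq_initVertex_iff hA hx'.2).2 h), mul_zero]
    · intro a ha
      have := @hA a
      simp only [Finset.mem_erase, Finset.mem_sdiff, Finset.mem_insert] at ha this ⊢
      tauto
  rw [CubeFormula, Finset.sum_congr rfl hterm, sum_predecessors (Precedes U L)]
  · simp only [facetCoord_eq_empty hA, facetCoord_eq_univ]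
  · intro x _ h; exact h.1 rfl
  · intro x _ y _ h; exact precedes_iff_not h
  · intro x hx y hy z hz
    rw [Finset.mem_sdiff] at hx hy hz
    refine precedes_trans_of_consistentAt hx.2 hy.2 hz.2 fun hxy hyz hxz => hU _ ?_ ?_
    · simp only [Finset.insert_subset_iff]
      exact ⟨hx.1, hy.1, hz.1, hLσ⟩
    · rw [Finset.card_insert_of_notMem, Finset.card_insert_of_notMem,
        Finset.card_insert_of_notMem hz.2, hL]
      · simp [hyz, hy.2]
      · simp [hxy, hxz, hx.2]
  · exact Finset.filter_subset _ _

/-! ### Coefficients whose factors miss one vertex of the simplex -/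

theorem model_ne_zero {k : ℕ} {U : Set (Finset V)} {τ X Y : Finset V} (h : model k U τ X Y ≠ 0) :
    X ∪ Y = τ ∧ (X ∩ Y).card = k ∧ X \ Y = initVertex U τ (X ∩ Y) := by
  by_contra h'
  exact h (if_neg h')

/-- A vertex `x` missing from both factors can be added to the first or, in `sign_extend_right`, to
the second. Both signs agree with the sign of the term on the face without `x`, up to the same
factor (-1)^(|L|-1). -/
theorem sign_extend_left {m : ℕ} {L A B : Finset V} {x : V}
    (hxA : x ∉ A) (hxB : x ∉ B) (hLA : Disjoint L A)
    (hLAB : Disjoint (L ∪ A) B) (hm : m = L.card + A.card + B.card) (hL : 0 < L.card) :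
    (-1 : ℤ) ^ below (L ∪ A) x * (-1) ^ signExp (m + 1) L (insert x A) B =
      (-1) ^ (L.card - 1) * ((-1) ^ below (L ∪ A ∪ B) x * (-1) ^ signExp m L A B) := by
  rw [← pow_add, ← pow_add, ← pow_add]
  apply neg_one_pow_congr
  rw [signExp_eq, signExp_eq, below_union hLAB, below_union hLA, ascents_insert_left hxA,
    Finset.card_insert_of_notMem hxA]
  have h2 := below_add_above hxB
  simp only [Nat.even_iff, mul_add, add_mul, one_mul, mul_one]
  omega

theorem sign_extend_right {m : ℕ} {L A B : Finset V} {x : V}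
    (hxB : x ∉ B) (hLA : Disjoint L A) (hLAB : Disjoint (L ∪ A) B) (hLB : Disjoint L B)
    (hL : 0 < L.card) :
    (-1 : ℤ) ^ ((L ∪ A).card - 1) *
        ((-1 : ℤ) ^ below (L ∪ B) x * (-1) ^ signExp (m + 1) L A (insert x B)) =
      (-1) ^ (L.card - 1) * ((-1) ^ below (L ∪ A ∪ B) x * (-1) ^ signExp m L A B) := by
  rw [← pow_add, ← pow_add, ← pow_add, ← pow_add]
  apply neg_one_pow_congr
  rw [signExp_eq, signExp_eq, below_union hLAB, below_union hLA, below_union hLB,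
    ascents_insert_right hxB, Finset.card_union_of_disjoint hLA, add_mul m 1]
  rw [Nat.even_iff, Nat.even_iff]
  omega

theorem initVertex_erase {U : Set (Finset V)} {σ L : Finset V} (w : V) :
    (initVertex U σ L).erase w = initVertex U (σ.erase w) L := by
  ext a
  simp only [Finset.mem_erase, mem_initVertex]
  tauto

/-- Here Δ∂ contributes through the face without `w` only, and `w` can be restored in either factor.
The terms match because deleting `w` from the initial vertex on `τ` gives the initial vertex on the
face. -/
theorem coeffFormula_model_of_union_eq_erase [Fintype V] {i : ℕ} {U : Set (Finset V)}
    {τ X Y : Finset V} {w : V} (hw : w ∈ τ) (hXY : X ∪ Y = τ.erase w)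
    (hcard : (X ∩ Y).card = i + 1) : CoeffFormula (model (i + 1) U) i τ X Y := by
  have hwXY : w ∉ X ∪ Y := by rw [hXY]; exact Finset.notMem_erase _ _
  have hτ : τ = insert w (X ∪ Y) := by rw [hXY, Finset.insert_erase hw]
  have hwX : w ∉ X := fun h => hwXY (Finset.mem_union_left _ h)
  have hwY : w ∉ Y := fun h => hwXY (Finset.mem_union_right _ h)
  have hne : X ∪ Y ≠ τ := by rw [hXY]; exact fun h => Finset.notMem_erase w τ (by rwa [h])
  have huniq : ∀ x, x ∈ τ → x ∉ X ∪ Y → x = w := by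
    intro x hx hx'
    rw [hτ] at hx
    exact (Finset.mem_insert.1 hx).resolve_right hx'
  have s1 : ∑ x ∈ Xᶜ, (-1) ^ below X x * model (i + 1) U τ (insert x X) Y =
      (-1) ^ below X w * model (i + 1) U τ (insert w X) Y := by
    apply Finset.sum_eq_single_of_mem _ (by simpa using hwX)
    intro x hx hxw
    by_contra h
    obtain ⟨h1, h2, -⟩ := model_ne_zero (right_ne_zero_of_mul h)
    refine hxw (huniq x (by rw [← h1]; simp) fun hx' => hne ?_)
    rw [← h1, Finset.insert_union, Finset.insert_eq_of_mem hx']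
  have s2 : ∑ y ∈ Yᶜ, (-1) ^ below Y y * model (i + 1) U τ X (insert y Y) =
      (-1) ^ below Y w * model (i + 1) U τ X (insert w Y) := by
    apply Finset.sum_eq_single_of_mem _ (by simpa using hwY)
    intro x hx hxw
    by_contra h
    obtain ⟨h1, h2, -⟩ := model_ne_zero (right_ne_zero_of_mul h)
    refine hxw (huniq x (by rw [← h1]; simp) fun hx' => hne ?_)
    rw [← h1, Finset.union_insert, Finset.insert_eq_of_mem hx']
  have s3 : ∑ x ∈ τ, (-1) ^ below τ x * model (i + 1) U (τ.erase x) X Y =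
      (-1) ^ below τ w * model (i + 1) U (τ.erase w) X Y := by
    apply Finset.sum_eq_single_of_mem _ hw
    intro x hx hxw
    by_contra h
    obtain ⟨h1, h2, -⟩ := model_ne_zero (right_ne_zero_of_mul h)
    refine hxw (huniq x hx ?_)
    rw [h1]; exact Finset.notMem_erase _ _
  have r1 : model i ∅ τ X Y = 0 := if_neg fun h => hne h.1
  have r2 : model i ∅ τ Y X = 0 := if_neg fun h => hne (Finset.union_comm X Y ▸ h.1)
  rw [CoeffFormula, s1, s2, s3, r1, r2]
  set L := X ∩ Y with hL
  set A := X \ Y with hA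
  set B := Y \ X with hB
  have eX : X = L ∪ A := by rw [hL, hA]; ext a; grind
  have eY : Y = L ∪ B := by rw [hL, hB]; ext a; grind
  have eXY : X ∪ Y = L ∪ A ∪ B := by rw [hL, hA, hB]; ext a; grind
  have dLA : Disjoint L A := Finset.disjoint_left.2 (by rw [hL, hA]; grind)
  have dLB : Disjoint L B := Finset.disjoint_left.2 (by rw [hL, hB]; grind)
  have dLAB : Disjoint (L ∪ A) B := Finset.disjoint_left.2 (by rw [hL, hA, hB]; grind)
  have hwA : w ∉ A := fun h => hwX (Finset.sdiff_subset h)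
  have hwB : w ∉ B := fun h => hwY (Finset.sdiff_subset h)
  have hcXY : (X ∪ Y).card = L.card + A.card + B.card := by
    rw [eXY, Finset.card_union_of_disjoint dLAB, Finset.card_union_of_disjoint dLA]
  have hcτ : τ.card = (X ∪ Y).card + 1 := by rw [hτ, Finset.card_insert_of_notMem hwXY]
  have a1 : insert w X ∩ Y = L := by rw [hL]; ext a; grind
  have a2 : insert w X \ Y = insert w A := by rw [hA]; ext a; grind
  have a3 : Y \ insert w X = B := by rw [hB]; ext a; grind
  have a4 : insert w X ∪ Y = τ := by rw [hτ, Finset.insert_union]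
  have b1 : X ∩ insert w Y = L := by rw [hL]; ext a; grind
  have b2 : X \ insert w Y = A := by rw [hA]; ext a; grind
  have b3 : insert w Y \ X = insert w B := by rw [hB]; ext a; grind
  have b4 : X ∪ insert w Y = τ := by rw [hτ, Finset.union_insert]
  have hl := sign_extend_left hwA hwB dLA dLAB hcXY (by omega)
  have hr := sign_extend_right (m := (X ∪ Y).card) hwB dLA dLAB dLB (by omega)
  rw [← hcτ, ← eXY, ← eX] at hl
  rw [← hcτ, ← eXY, ← eX, ← eY] at hr
  have hb : below τ w = below (X ∪ Y) w := by rw [hXY, below_erase_self]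
  have hi : L.card - 1 = i := by omega
  rw [hi] at hl hr
  simp only [model, a1, a2, a3, a4, b1, b2, b3, b4, ← hL, ← hA, ← hB, hcard, ← hXY, true_and, hb]
  rw [hXY, ← initVertex_erase, ← hXY]
  -- The vertex `w` goes to the first factor if it belongs to the initial vertex, and to the second
  -- otherwise; exactly one of the two sums can contribute.
  by_cases hwi : w ∈ initVertex U τ L
  · have e1 : insert w A = initVertex U τ L ↔ A = (initVertex U τ L).erase w := by
      constructor
      · intro h; rw [← h, Finset.erase_insert hwA]
      · intro h; rw [h, Finset.insert_erase hwi]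
    have e2 : A ≠ initVertex U τ L := by rintro h; rw [← h] at hwi; exact hwA hwi
    rw [if_neg e2]
    simp only [e1]
    split_ifs
    · linear_combination hl
    · simp
  · have e1 : insert w A ≠ initVertex U τ L := by
      intro h; rw [← h] at hwi; exact hwi (Finset.mem_insert_self _ _)
    rw [if_neg e1, Finset.erase_eq_of_notMem hwi]
    split_ifs
    · linear_combination hr
    · simp

/-- The coefficients of a consistent set satisfy the homotopy formula. -/
theorem coeffFormula_model [Fintype V] {i : ℕ} {U : Set (Finset V)} {τ X Y : Finset V}
    (hU : ∀ M ⊆ τ, M.card = i + 3 → ConsistentAt U M) (hX : X.Nonempty) (hY : Y.Nonempty) :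
    CoeffFormula (model (i + 1) U) i τ X Y := by
  by_cases hfacet : X ∪ Y = τ ∧ (X ∩ Y).card = i
  · obtain ⟨h1, h2⟩ := hfacet
    have eX : X = X ∩ Y ∪ X \ Y := by ext a; grind
    have eY : Y = τ \ (X \ Y) := by rw [← h1]; ext a; grind
    have hA : X \ Y ⊆ τ \ (X ∩ Y) := by rw [← h1]; intro a; grind
    have hLτ : X ∩ Y ⊆ τ := by rw [← h1]; intro a; grind
    have key := coeffFormula_iff_cubeFormula (c := model (i + 1) U) (i := i) (σ := τ)
      (L := X ∩ Y) (A := X \ Y) (by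
        intro τ' _ X' Y' h
        rw [← (model_ne_zero h).1]
        exact ⟨Finset.subset_union_left, Finset.subset_union_right⟩) hLτ h2 hA
      (by rwa [← eX]) (by rwa [← eY])
    rw [← eX, ← eY] at key
    exact key.2 (cubeFormula_model hU hLτ h2 hA)
  by_cases hface : ∃ w ∈ τ, X ∪ Y = τ.erase w ∧ (X ∩ Y).card = i + 1
  · obtain ⟨w, hw, h1, h2⟩ := hface
    exact coeffFormula_model_of_union_eq_erase hw h1 h2
  -- Adding a vertex to one factor enlarges either the intersection or the union by one. A nonzero
  -- term would therefore lead back to one of the two cases already treated.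
  have erase_of : ∀ x, x ∉ X ∪ Y → insert x (X ∪ Y) = τ → (X ∩ Y).card ≠ i + 1 := by
    intro x hx h h'
    refine hface ⟨x, by rw [← h]; simp, ?_, h'⟩
    rw [← h, Finset.erase_insert hx]
  rw [CoeffFormula, Finset.sum_eq_zero, Finset.sum_eq_zero, Finset.sum_eq_zero]
  · have r1 : model i ∅ τ X Y = 0 := if_neg fun h => hfacet ⟨h.1, h.2.1⟩
    have r2 : model i ∅ τ Y X = 0 :=
      if_neg fun h => hfacet ⟨Finset.union_comm X Y ▸ h.1, Finset.inter_comm X Y ▸ h.2.1⟩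
    rw [r1, r2]
    ring
  · intro w hw
    by_contra h
    obtain ⟨h1, h2, -⟩ := model_ne_zero (right_ne_zero_of_mul h)
    exact hface ⟨w, hw, h1, h2⟩
  · intro y hy
    by_contra h
    obtain ⟨h1, h2, -⟩ := model_ne_zero (right_ne_zero_of_mul h)
    rw [Finset.mem_compl] at hy
    rw [Finset.union_insert] at h1
    by_cases hyX : y ∈ X
    · rw [Finset.inter_insert_of_mem hyX, Finset.card_insert_of_notMem (by simp [hy])] at h2
      rw [Finset.insert_eq_of_mem (Finset.mem_union_left _ hyX)] at h1
      exact hfacet ⟨h1, by omega⟩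
    · rw [Finset.inter_insert_of_notMem hyX] at h2
      exact erase_of y (by simp [hyX, hy]) h1 h2
  · intro x hx
    by_contra h
    obtain ⟨h1, h2, -⟩ := model_ne_zero (right_ne_zero_of_mul h)
    rw [Finset.mem_compl] at hx
    rw [Finset.insert_union] at h1
    by_cases hxY : x ∈ Y
    · rw [Finset.insert_inter_of_mem hxY, Finset.card_insert_of_notMem (by simp [hx])] at h2
      rw [Finset.insert_eq_of_mem (Finset.mem_union_right _ hxY)] at h1
      exact hfacet ⟨h1, by omega⟩
    · rw [Finset.insert_inter_of_notMem hxY] at h2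
      exact erase_of x (by simp [hxY, hx]) h1 h2

end

section

variable {V : Type*} [LinearOrder V] {K : PreAbstractSimplicialComplex V}

/-! ### Coefficients of chains and tensors -/

open Classical in
/-- The coefficient of a set of vertices in a chain, zero if the set is not a simplex. -/
def chainCoeff (K : PreAbstractSimplicialComplex V) (s : Finset V) : Chains K →ₗ[ℤ] ℤ :=
  if h : s ∈ K.faces then Finsupp.lapply ⟨s, h⟩ else 0

open Classical in
/-- The coefficient of `X ⊗ Y` in a tensor, zero if `X` or `Y` is not a simplex. -/
def tensorCoeff (K : PreAbstractSimplicialComplex V) (X Y : Finset V) :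
    Chains K ⊗[ℤ] Chains K →+ ℤ :=
  if h : X ∈ K.faces ∧ Y ∈ K.faces then
    (Finsupp.applyAddHom ((⟨X, h.1⟩, ⟨Y, h.2⟩) : K.faces × K.faces)).comp
      (finsuppTensorFinsupp' ℤ K.faces K.faces).toLinearMap.toAddMonoidHom
  else 0

open Classical in
theorem tensorCoeff_of_mem {X Y : Finset V} (hX : X ∈ K.faces) (hY : Y ∈ K.faces)
    (z : Chains K ⊗[ℤ] Chains K) : tensorCoeff K X Y z =
      finsuppTensorFinsupp' ℤ K.faces K.faces z (⟨X, hX⟩, ⟨Y, hY⟩) := by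
  unfold tensorCoeff
  rw [dif_pos ⟨hX, hY⟩]
  rfl

/-- The coefficients of a map to the tensor square. -/
def mapCoeff (D : Chains K →ₗ[ℤ] Chains K ⊗[ℤ] Chains K) (τ X Y : Finset V) : ℤ :=
  tensorCoeff K X Y (D (chain K τ))

theorem nonempty_of_mem_faces {s : Finset V} (hs : s ∈ K.faces) : s.Nonempty :=
  Finset.nonempty_iff_ne_empty.2 fun h => (K.isRelLowerSet_faces.prop_of_mem hs).ne_empty h

theorem mem_faces_of_subset {s t : Finset V} (ht : t ∈ K.faces) (hst : s ⊆ t) (hs : s.Nonempty) :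
    s ∈ K.faces := (K.isRelLowerSet_faces ht).2 hst hs

theorem chain_of_mem {s : Finset V} (hs : s ∈ K.faces) :
    chain K s = Finsupp.single ⟨s, hs⟩ 1 := dif_pos hs

theorem chain_of_notMem {s : Finset V} (hs : s ∉ K.faces) : chain K s = 0 := dif_neg hs

theorem chain_empty : chain K ∅ = 0 := 
  chain_of_notMem fun h => Finset.not_nonempty_empty (nonempty_of_mem_faces h)

theorem chain_coe (σ : K.faces) : chain K σ.1 = Finsupp.single σ 1 := chain_of_mem σ.2

theorem chainCoeff_of_mem {s : Finset V} (hs : s ∈ K.faces) (a : Chains K) :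
    chainCoeff K s a = a ⟨s, hs⟩ := by
  simp [chainCoeff, hs]

theorem chainCoeff_of_notMem {s : Finset V} (hs : s ∉ K.faces) (a : Chains K) :
    chainCoeff K s a = 0 := by
  simp [chainCoeff, hs]

open Classical in
theorem chainCoeff_chain (s t : Finset V) :
    chainCoeff K s (chain K t) = if s = t ∧ t ∈ K.faces then 1 else 0 := by
  by_cases hs : s ∈ K.faces
  · rw [chainCoeff_of_mem hs]
    by_cases ht : t ∈ K.faces
    · rw [chain_of_mem ht, Finsupp.single_apply]
      simp [ht, eq_comm]
    · simp [chain_of_notMem ht, ht]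
  · rw [chainCoeff_of_notMem hs, if_neg]
    rintro ⟨rfl, h⟩
    exact hs h

theorem tensorCoeff_tmul (X Y : Finset V) (a b : Chains K) :
    tensorCoeff K X Y (a ⊗ₜ[ℤ] b) = chainCoeff K X a * chainCoeff K Y b := by
  by_cases h : X ∈ K.faces ∧ Y ∈ K.faces
  · rw [chainCoeff_of_mem h.1, chainCoeff_of_mem h.2, tensorCoeff_of_mem h.1 h.2,
      finsuppTensorFinsupp'_apply_apply]
  · rw [tensorCoeff, dif_neg h]
    rw [not_and_or] at h
    rcases h with h | h <;> simp [chainCoeff_of_notMem h]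

theorem tensorCoeff_of_notMem {X Y : Finset V} (h : ¬ (X ∈ K.faces ∧ Y ∈ K.faces))
    (z : Chains K ⊗[ℤ] Chains K) : tensorCoeff K X Y z = 0 := by
  simp [tensorCoeff, h]

theorem tensor_ext {z z' : Chains K ⊗[ℤ] Chains K}
    (h : ∀ X ∈ K.faces, ∀ Y ∈ K.faces, tensorCoeff K X Y z = tensorCoeff K X Y z') : z = z' := by
  apply (finsuppTensorFinsupp' ℤ K.faces K.faces).injective
  ext ⟨X, Y⟩
  have := h X.1 X.2 Y.1 Y.2
  rwa [tensorCoeff_of_mem X.2 Y.2, tensorCoeff_of_mem X.2 Y.2] at this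

theorem mem_terms {z : Chains K ⊗[ℤ] Chains K} {p : K.faces × K.faces} :
    p ∈ terms z ↔ tensorCoeff K p.1.1 p.2.1 z ≠ 0 := by
  rw [tensorCoeff_of_mem p.1.2 p.2.2, terms, Finsupp.mem_support_iff]

theorem chains_hom_ext {M : Type*} [AddCommGroup M] {f g : Chains K →ₗ[ℤ] M}
    (h : ∀ s ∈ K.faces, f (chain K s) = g (chain K s)) : f = g := by
  apply Finsupp.lhom_ext'
  intro σ
  apply LinearMap.ext_ring
  have := h σ.1 σ.2
  rw [chain_coe] at this
  simpa using this

theorem mapCoeff_ext {D D' : Chains K →ₗ[ℤ] Chains K ⊗[ℤ] Chains K}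
    (h : ∀ τ ∈ K.faces, ∀ X ∈ K.faces, ∀ Y ∈ K.faces, mapCoeff D τ X Y = mapCoeff D' τ X Y) :
    D = D' :=
  chains_hom_ext fun τ hτ => tensor_ext fun X hX Y hY => h τ hτ X hX Y hY

theorem boundary_chain {s : Finset V} (hs : s ∈ K.faces) :
    boundary K (chain K s) = ∑ v ∈ s, (-1 : ℤ) ^ below s v • chain K (s.erase v) := by
  rw [chain_of_mem hs, boundary, Finsupp.linearCombination_single, one_smul]
  rfl

theorem chainCoeff_boundary [Fintype V] {s : Finset V} (hs : s ∈ K.faces) (a : Chains K) :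
    chainCoeff K s (boundary K a) =
      ∑ x ∈ sᶜ, (-1) ^ below s x * chainCoeff K (insert x s) a := by
  classical
  suffices h : chainCoeff K s ∘ₗ boundary K =
      ∑ x ∈ sᶜ, (-1 : ℤ) ^ below s x • chainCoeff K (insert x s) by
    have := LinearMap.congr_fun h a
    simpa using this
  apply chains_hom_ext
  intro t ht
  simp only [LinearMap.comp_apply, boundary_chain ht, map_sum, map_smul, chainCoeff_chain,
    LinearMap.sum_apply, LinearMap.smul_apply, ht, and_true, smul_eq_mul]
  have h1 : ∀ S : Finset V, ∀ f : V → ℤ, ∑ x ∈ S, f x = ∑ x, if x ∈ S then f x else 0 := by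
    intro S f; simp
  rw [h1 t, h1 sᶜ]
  apply Finset.sum_congr rfl
  intro x _
  by_cases h : x ∈ t ∧ s = t.erase x
  · obtain ⟨hx, rfl⟩ := h
    rw [if_pos hx, if_pos ⟨rfl, hs⟩, if_pos (by simp), if_pos (Finset.insert_erase hx),
      below_erase_self]
  · have h' : ¬ (x ∉ s ∧ insert x s = t) := by
      rintro ⟨hx, rfl⟩
      exact h ⟨Finset.mem_insert_self _ _, (Finset.erase_insert hx).symm⟩
    rw [not_and] at h h'
    have l : (if x ∈ t then (-1 : ℤ) ^ below t x *
        (if s = t.erase x ∧ t.erase x ∈ K.faces then 1 else 0) else 0) = 0 := by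
      split_ifs with h2 h3
      · exact absurd h3.1 (h h2)
      all_goals simp
    have r : (if x ∈ sᶜ then (-1 : ℤ) ^ below s x * (if insert x s = t then 1 else 0) else 0)
        = 0 := by
      split_ifs with h2 h3
      · exact absurd h3 (h' (by simpa using h2))
      all_goals simp
    rw [l, r]

theorem signMap_chain (s : Finset V) :
    signMap K (chain K s) = (-1 : ℤ) ^ (s.card - 1) • chain K s := by
  by_cases hs : s ∈ K.faces
  · rw [chain_of_mem hs, signMap, Finsupp.linearCombination_single, one_smul]
    rfl
  · simp [chain_of_notMem hs]

theorem chainCoeff_signMap (s : Finset V) (a : Chains K) :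
    chainCoeff K s (signMap K a) = (-1) ^ (s.card - 1) * chainCoeff K s a := by
  classical
  suffices h : chainCoeff K s ∘ₗ signMap K = (-1 : ℤ) ^ (s.card - 1) • chainCoeff K s by
    have := LinearMap.congr_fun h a
    simpa using this
  apply chains_hom_ext
  intro t ht
  simp only [LinearMap.comp_apply, signMap_chain, map_smul, chainCoeff_chain,
    LinearMap.smul_apply, ht, and_true, smul_eq_mul]
  split_ifs with h
  · rw [h]
  · simp

theorem tensorBoundary_tmul (a b : Chains K) :
    tensorBoundary K (a ⊗ₜ[ℤ] b) =
      boundary K a ⊗ₜ[ℤ] b + signMap K a ⊗ₜ[ℤ] boundary K b := rfl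

theorem tensorCoeff_tensorBoundary [Fintype V] {X Y : Finset V} (hX : X ∈ K.faces)
    (hY : Y ∈ K.faces) (z : Chains K ⊗[ℤ] Chains K) :
    tensorCoeff K X Y (tensorBoundary K z) =
      ∑ x ∈ Xᶜ, (-1) ^ below X x * tensorCoeff K (insert x X) Y z +
        (-1) ^ (X.card - 1) * ∑ y ∈ Yᶜ, (-1) ^ below Y y * tensorCoeff K X (insert y Y) z := by
  induction z using TensorProduct.induction_on with
  | zero => simp
  | tmul a b =>
    simp only [tensorBoundary_tmul, map_add, tensorCoeff_tmul, chainCoeff_boundary hX, chainCoeff_boundary hY,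
      chainCoeff_signMap, Finset.sum_mul, Finset.mul_sum]
    congr 1
    · exact Finset.sum_congr rfl fun x _ => by ring
    · exact Finset.sum_congr rfl fun x _ => by ring
  | add z w hz hw =>
    simp only [map_add, hz, hw, mul_add, Finset.sum_add_distrib]
    ring

theorem swap_tmul_chain {s t : Finset V} (hs : s ∈ K.faces) (ht : t ∈ K.faces) :
    swap K (chain K s ⊗ₜ[ℤ] chain K t) =
      (-1 : ℤ) ^ ((s.card - 1) * (t.card - 1)) • (chain K t ⊗ₜ[ℤ] chain K s) := by
  have h : swap K (chain K s ⊗ₜ[ℤ] chain K t) =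
      (Finsupp.linearCombination ℤ fun σ : K.faces =>
        Finsupp.linearCombination ℤ fun τ : K.faces =>
          (-1 : ℤ) ^ (dim σ * dim τ) •
            ((Finsupp.single τ (1 : ℤ) : Chains K) ⊗ₜ[ℤ] (Finsupp.single σ (1 : ℤ) : Chains K)))
        (chain K s) (chain K t) := rfl
  rw [h, chain_of_mem hs, chain_of_mem ht, Finsupp.linearCombination_single, one_smul,
    Finsupp.linearCombination_single, one_smul]
  rfl

theorem tensor_hom_ext {M : Type*} [AddCommGroup M] {f g : Chains K ⊗[ℤ] Chains K →+ M}
    (h : ∀ s ∈ K.faces, ∀ t ∈ K.faces,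
      f (chain K s ⊗ₜ[ℤ] chain K t) = g (chain K s ⊗ₜ[ℤ] chain K t)) : f = g := by
  have h1 : ∀ (σ : K.faces) (b : Chains K),
      f (Finsupp.single σ (1 : ℤ) ⊗ₜ[ℤ] b) = g (Finsupp.single σ (1 : ℤ) ⊗ₜ[ℤ] b) := by
    intro σ b
    have : f.comp (TensorProduct.mk ℤ (Chains K) (Chains K) (Finsupp.single σ 1)).toAddMonoidHom =
        g.comp (TensorProduct.mk ℤ (Chains K) (Chains K) (Finsupp.single σ 1)).toAddMonoidHom := by
      ext τ
      have := h σ.1 σ.2 τ.1 τ.2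
      rw [chain_coe, chain_coe] at this
      exact this
    exact DFunLike.congr_fun this b
  have h2 : ∀ a b : Chains K, f (a ⊗ₜ[ℤ] b) = g (a ⊗ₜ[ℤ] b) := by
    intro a b
    have : f.comp ((TensorProduct.mk ℤ (Chains K) (Chains K)).flip b).toAddMonoidHom =
        g.comp ((TensorProduct.mk ℤ (Chains K) (Chains K)).flip b).toAddMonoidHom := by
      ext σ
      exact h1 σ b
    exact DFunLike.congr_fun this a
  ext z
  induction z using TensorProduct.induction_on with
  | zero => simp
  | tmul a b => exact h2 a b
  | add z w hz hw => rw [map_add, map_add, hz, hw]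

theorem tensorCoeff_swap (X Y : Finset V) (z : Chains K ⊗[ℤ] Chains K) :
    tensorCoeff K X Y (swap K z) =
      (-1) ^ ((X.card - 1) * (Y.card - 1)) * tensorCoeff K Y X z := by
  classical
  suffices h : (tensorCoeff K X Y).comp (swap K).toAddMonoidHom =
      (-1 : ℤ) ^ ((X.card - 1) * (Y.card - 1)) • tensorCoeff K Y X by
    have := DFunLike.congr_fun h z
    simpa using this
  apply tensor_hom_ext
  intro s hs t ht
  simp only [AddMonoidHom.comp_apply, LinearMap.toAddMonoidHom_coe, swap_tmul_chain hs ht,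
    map_zsmul, tensorCoeff_tmul, chainCoeff_chain, AddMonoidHom.smul_apply, hs, ht, and_true,
    smul_eq_mul]
  by_cases h1 : X = t <;> by_cases h2 : Y = s <;> simp [h1, h2, mul_comm]

/-! ### From maps to families of coefficients -/

/-- The homotopy formula on the simplex `τ`. -/
def HomotopyFormulaAt (K : PreAbstractSimplicialComplex V) (i : ℕ)
    (D : Chains K →ₗ[ℤ] Chains K ⊗[ℤ] Chains K) (τ : Finset V) : Prop :=
  tensorBoundary K (D (chain K τ)) - (-1 : ℤ) ^ i • D (boundary K (chain K τ)) =
    prevCoproduct K i (chain K τ) + (-1 : ℤ) ^ i • swap K (prevCoproduct K i (chain K τ))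

theorem homotopyFormula_iff {i : ℕ} {D : Chains K →ₗ[ℤ] Chains K ⊗[ℤ] Chains K} :
    HomotopyFormula K i D ↔ ∀ τ ∈ K.faces, HomotopyFormulaAt K i D τ := by
  constructor
  · intro h τ _
    exact LinearMap.congr_fun h (chain K τ)
  · intro h
    apply chains_hom_ext
    intro τ hτ
    exact h τ hτ

theorem initVertex_restrict {i : ℕ} {U : Set (Finset V)} {σ L : Finset V} (hL : L ⊆ σ)
    (hcard : L.card = i + 1) : initVertex (restrict i U σ) σ L = initVertex U σ L := by
  ext a
  rw [mem_initVertex, mem_initVertex]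
  refine and_congr_right fun ⟨ha, haL⟩ => ?_
  have : insert a L ∈ restrict i U σ ↔ insert a L ∈ U := by
    simp [restrict, Finset.insert_subset_iff, ha, hL, Finset.card_insert_of_notMem haL, hcard]
  rw [this]

/-- The factors determine `L` as their intersection, so at most one summand of the coproduct
contributes to a given coefficient. -/
theorem mapCoeff_coproduct {i : ℕ} {U : Set (Finset V)} {τ X Y : Finset V} (hτ : τ ∈ K.faces)
    (hX : X ∈ K.faces) (hY : Y ∈ K.faces) :
    mapCoeff (coproduct K i U) τ X Y = model (i + 1) U τ X Y := by
  classical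
  have hval : coproduct K i U (chain K τ) = simplexCoproduct K i (restrict i U τ) τ := by
    rw [chain_of_mem hτ, coproduct, Finsupp.linearCombination_single, one_smul]
  rw [mapCoeff, hval, simplexCoproduct, map_sum]
  have hterm : ∀ L ∈ τ.powersetCard (i + 1),
      tensorCoeff K X Y ((-1 : ℤ) ^ signExp τ.card L (initVertex (restrict i U τ) τ L)
        (coVertex (restrict i U τ) τ L) • (chain K (L ∪ initVertex (restrict i U τ) τ L) ⊗ₜ[ℤ]
          chain K (L ∪ coVertex (restrict i U τ) τ L))) =
      if L = X ∩ Y then model (i + 1) U τ X Y else 0 := by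
    intro L hL
    rw [Finset.mem_powersetCard] at hL
    have hA : ∀ a, a ∈ initVertex U τ L → a ∈ τ ∧ a ∉ L := fun a ha => (mem_initVertex.1 ha).1
    rw [coVertex, initVertex_restrict hL.1 hL.2, map_zsmul, tensorCoeff_tmul, chainCoeff_chain,
      chainCoeff_chain]
    set A := initVertex U τ L with hAdef
    have hiff : (X = L ∪ A ∧ L ∪ A ∈ K.faces) ∧
        (Y = L ∪ τ \ (L ∪ A) ∧ L ∪ τ \ (L ∪ A) ∈ K.faces) ↔
        L = X ∩ Y ∧ X ∪ Y = τ ∧ X \ Y = A := by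
      constructor
      · rintro ⟨⟨h1, -⟩, h2, -⟩
        have hsub := hL.1
        refine ⟨?_, ?_, ?_⟩ <;>
        · rw [h1, h2]
          ext a
          have := hA a
          have := @hsub a
          grind
      · rintro ⟨h1, h2, h3⟩
        have e1 : X = L ∪ A := by rw [h1, ← h3]; ext a; grind
        have e2 : Y = L ∪ τ \ (L ∪ A) := by rw [h1, ← h3, ← h2]; ext a; grind
        exact ⟨⟨e1, e1 ▸ hX⟩, e2, e2 ▸ hY⟩
    by_cases h : (X = L ∪ A ∧ L ∪ A ∈ K.faces) ∧
        (Y = L ∪ τ \ (L ∪ A) ∧ L ∪ τ \ (L ∪ A) ∈ K.faces)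
    · obtain ⟨h1, h2, h3⟩ := hiff.1 h
      rw [if_pos h.1, if_pos h.2, if_pos h1, model, ← h1, if_pos ⟨h2, hL.2, h3⟩, h3]
      have : Y \ X = τ \ (L ∪ A) := by
        rw [h1, ← h2, ← h3]; ext a; grind
      rw [this]; simp
    · have h' := mt hiff.2 h
      have l : (if X = L ∪ A ∧ L ∪ A ∈ K.faces then (1 : ℤ) else 0) *
        (if Y = L ∪ τ \ (L ∪ A) ∧ L ∪ τ \ (L ∪ A) ∈ K.faces then 1 else 0) = 0 := by
        rw [not_and_or] at h
        rcases h with h | h <;> rw [if_neg h] <;> simp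
      rw [l, smul_zero]
      split_ifs with hLXY
      · rw [model, if_neg]
        rw [← hLXY]
        rintro ⟨h1, -, h2⟩
        exact h' ⟨hLXY, h1, h2⟩
      · rfl
  rw [Finset.sum_congr rfl hterm, Finset.sum_ite_eq']
  split_ifs with h
  · rfl
  · symm
    by_contra h0
    obtain ⟨h1, h2, -⟩ := model_ne_zero h0
    refine h (Finset.mem_powersetCard.2 ⟨?_, h2⟩)
    rw [← h1]
    exact Finset.inter_subset_left.trans Finset.subset_union_left

theorem mapCoeff_prevCoproduct {i : ℕ} {τ X Y : Finset V} (hτ : τ ∈ K.faces)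
    (hX : X ∈ K.faces) (hY : Y ∈ K.faces) :
    mapCoeff (prevCoproduct K i) τ X Y = model i ∅ τ X Y := by
  cases i with
  | succ i => exact mapCoeff_coproduct hτ hX hY
  | zero =>
    -- For `k = 0` the family `model` is not identically zero, but its only nonzero coefficients
    -- have empty first factor, which is not a simplex.
    have : model 0 ∅ τ X Y = 0 := by
      by_contra h
      obtain ⟨h1, h2, h3⟩ := model_ne_zero h
      rw [Finset.card_eq_zero] at h2
      have h4 : X \ Y = ∅ := by
        rw [h3, h2]
        ext a
        simp [mem_initVertex, EvenGap]
      obtain ⟨x, hx⟩ := nonempty_of_mem_faces hX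
      by_cases hxY : x ∈ Y
      · exact Finset.notMem_empty x (h2 ▸ Finset.mem_inter.2 ⟨hx, hxY⟩)
      · exact Finset.notMem_empty x (h4 ▸ Finset.mem_sdiff.2 ⟨hx, hxY⟩)
    rw [this]
    simp [mapCoeff, prevCoproduct]

theorem homotopyFormulaAt_iff [Fintype V] {i : ℕ} {D : Chains K →ₗ[ℤ] Chains K ⊗[ℤ] Chains K}
    {τ : Finset V} (hτ : τ ∈ K.faces) :
    HomotopyFormulaAt K i D τ ↔
      ∀ X ∈ K.faces, ∀ Y ∈ K.faces, CoeffFormula (mapCoeff D) i τ X Y := by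
  have key : ∀ X ∈ K.faces, ∀ Y ∈ K.faces, (tensorCoeff K X Y
      (tensorBoundary K (D (chain K τ)) - (-1 : ℤ) ^ i • D (boundary K (chain K τ))) =
      tensorCoeff K X Y
    (prevCoproduct K i (chain K τ) + (-1 : ℤ) ^ i • swap K (prevCoproduct K i (chain K τ)))) ↔
    CoeffFormula (mapCoeff D) i τ X Y := by
    intro X hX Y hY
    have e1 := mapCoeff_prevCoproduct (i := i) hτ hX hY
    have e2 := mapCoeff_prevCoproduct (i := i) hτ hY hX
    simp only [mapCoeff] at e1 e2
    rw [CoeffFormula, map_sub, map_add, tensorCoeff_tensorBoundary hX hY, map_zsmul, map_zsmul,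
      tensorCoeff_swap, e1, e2, boundary_chain hτ]
    simp only [map_sum, map_smul, map_zsmul, smul_eq_mul, mapCoeff]
  constructor
  · intro h X hX Y hY
    exact (key X hX Y hY).1 (congrArg _ h)
  · intro h
    exact tensor_ext fun X hX Y hY => (key X hX Y hY).2 (h X hX Y hY)

theorem mapCoeff_ne_zero {D : Chains K →ₗ[ℤ] Chains K ⊗[ℤ] Chains K} {τ X Y : Finset V}
    (h : mapCoeff D τ X Y ≠ 0) : τ ∈ K.faces ∧ X ∈ K.faces ∧ Y ∈ K.faces := by
  constructor
  · by_contra h'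
    exact h (by simp [mapCoeff, chain_of_notMem h'])
  · by_contra h'
    exact h (tensorCoeff_of_notMem h' _)

/-- The formula at X ⊗ Y only sees coefficients on faces of `τ` at pairs containing X and Y. This
allows passage between `model`, which ignores the complex, and the coefficients of an actual map. -/
theorem coeffFormula_congr [Fintype V] {c c' : Finset V → Finset V → Finset V → ℤ} {i : ℕ}
    {τ X Y : Finset V} (h : ∀ τ' ⊆ τ, ∀ X' Y', X ⊆ X' → Y ⊆ Y' → c τ' X' Y' = c' τ' X' Y') :
    CoeffFormula c i τ X Y ↔ CoeffFormula c' i τ X Y := by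
  simp only [CoeffFormula, h _ (Finset.erase_subset _ _) _ _ subset_rfl subset_rfl,
    h _ subset_rfl _ _ (Finset.subset_insert _ X) subset_rfl,
    h _ subset_rfl _ _ subset_rfl (Finset.subset_insert _ Y)]

/-- For every consistent set, the coproduct satisfies the homotopy formula. -/
theorem homotopyFormula_coproduct [Fintype V] {i : ℕ} {U : Set (Finset V)}
    (hU : IsConsistent K i U) : HomotopyFormula K i (coproduct K i U) := by
  rw [homotopyFormula_iff]
  intro τ hτ
  rw [homotopyFormulaAt_iff hτ]
  intro X hX Y hY
  rw [coeffFormula_congr (c' := model (i + 1) U)]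
  · refine coeffFormula_model ?_ (nonempty_of_mem_faces hX) (nonempty_of_mem_faces hY)
    intro M hM hcard
    exact hU.2 M (mem_faces_of_subset hτ hM (Finset.card_pos.1 (by omega))) hcard
  · intro τ' hτ' X' Y' hX' hY'
    by_cases h : τ' ∈ K.faces ∧ X' ∈ K.faces ∧ Y' ∈ K.faces
    · exact mapCoeff_coproduct h.1 h.2.1 h.2.2
    · have h0 : mapCoeff (coproduct K i U) τ' X' Y' = 0 := by
        by_contra h0
        exact h (mapCoeff_ne_zero h0)
      rw [h0]
      -- A nonzero `model` coefficient has its factors inside `τ'`. They contain the non-empty sets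
      -- X and Y, so everything involved is a face and the coefficients agree after all.
      by_contra h1
      have h2 := (model_ne_zero (Ne.symm h1)).1
      have hne := nonempty_of_mem_faces hX
      have hX'' : X' ⊆ τ' := by rw [← h2]; exact Finset.subset_union_left
      have hY'' : Y' ⊆ τ' := by rw [← h2]; exact Finset.subset_union_right
      have hneX := hne.mono hX'
      exact h ⟨mem_faces_of_subset hτ hτ' (hneX.mono hX''),
        mem_faces_of_subset hτ (hX''.trans hτ') hneX,
        mem_faces_of_subset hτ (hY''.trans hτ') ((nonempty_of_mem_faces hY).mono hY')⟩

end

section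

variable {V : Type*} [LinearOrder V]

/-! ### Every local solution has a term for each generating set -/

/-- The family `c` of coefficients is a local normalised solution of the homotopy formula on the
faces of `σ`. -/
structure IsLocalSolution [Fintype V] (c : Finset V → Finset V → Finset V → ℤ) (i : ℕ)
    (σ : Finset V) : Prop where
  subset : ∀ τ ⊆ σ, ∀ X Y, c τ X Y ≠ 0 → X ⊆ τ ∧ Y ⊆ τ
  nonempty : ∀ τ X Y, c τ X Y ≠ 0 → X.Nonempty ∧ Y.Nonempty
  formula : ∀ τ ⊆ σ, τ.Nonempty → ∀ X ⊆ τ, X.Nonempty → ∀ Y ⊆ τ, Y.Nonempty →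
    CoeffFormula c i τ X Y
  normalized : i = 0 → ∀ v ∈ σ, c {v} {v} {v} = 1

theorem IsLocalSolution.mono [Fintype V] {c : Finset V → Finset V → Finset V → ℤ} {i : ℕ}
    {σ τ : Finset V} (h : IsLocalSolution c i σ) (hτ : τ ⊆ σ) : IsLocalSolution c i τ where
  subset := fun ρ hρ => h.subset ρ (hρ.trans hτ)
  nonempty := h.nonempty
  formula := fun ρ hρ => h.formula ρ (hρ.trans hτ)
  normalized := fun hi v hv => h.normalized hi v (hτ hv)

theorem sum_powerset_eq_sum_powerset_erase {S : Finset V} {x : V} (hx : x ∈ S)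
    (f : Finset V → ℤ) :
    ∑ A ∈ S.powerset, f A = ∑ A ∈ (S.erase x).powerset, (f A + f (insert x A)) := by
  conv_lhs => rw [← Finset.insert_erase hx]
  rw [Finset.sum_powerset_insert (Finset.notMem_erase x S), Finset.sum_add_distrib]

/-- The total of the cubical boundary over all facets with generating vectors `L`, weighted by a
function that does not depend on the coordinate `x`. -/
theorem sum_facetSign_mul_eq_zero {S L : Finset V} {x : V} (hx : x ∈ S) (g : Finset V → ℤ) :
    ∑ A ∈ S.powerset, facetSign L A x * g (A.erase x) = 0 := by
  rw [sum_powerset_eq_sum_powerset_erase hx]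
  apply Finset.sum_eq_zero
  intro A hA
  have hxA : x ∉ A := fun h => Finset.notMem_erase x S (Finset.mem_powerset.1 hA h)
  rw [Finset.erase_insert hxA, Finset.erase_eq_of_notMem hxA, facetSign_of_notMem hxA,
    facetSign_of_mem (Finset.mem_insert_self x A)]
  ring

theorem initVertex_subset {U : Set (Finset V)} {σ L : Finset V} : initVertex U σ L ⊆ σ \ L :=
  fun _ ha => Finset.mem_sdiff.2 (mem_initVertex.1 ha).1

theorem sum_ite_eq_initVertex (σ L : Finset V) :
    ∑ A ∈ (σ \ L).powerset, ((if A = initVertex ∅ σ L then (1 : ℤ) else 0) -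
      if σ \ (L ∪ A) = initVertex ∅ σ L then 1 else 0) = 0 := by
  rw [Finset.sum_sub_distrib, Finset.sum_ite_eq',
    if_pos (Finset.mem_powerset.2 initVertex_subset)]
  have : ∀ A ∈ (σ \ L).powerset, (if σ \ (L ∪ A) = initVertex ∅ σ L then (1 : ℤ) else 0) =
      if A = (σ \ L) \ initVertex ∅ σ L then 1 else 0 := by
    intro A hA
    have hA := Finset.mem_powerset.1 hA
    have hO := initVertex_subset (U := ∅) (σ := σ) (L := L)
    congr 1
    rw [eq_iff_iff]
    rw [show σ \ (L ∪ A) = (σ \ L) \ A by ext a; simp; tauto]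
    constructor
    · intro h; rw [← h, Finset.sdiff_sdiff_eq_self hA]
    · intro h; rw [h, Finset.sdiff_sdiff_eq_self hO]
  rw [Finset.sum_congr rfl this, Finset.sum_ite_eq',
    if_pos (Finset.mem_powerset.2 Finset.sdiff_subset), sub_self]

/-- Summed over all facets with directions `L`, both sides vanish: opposite facets of each cube
cancel, and so do the initial and final facets. Hence one missing equation follows from the others.
-/
theorem cubeFormula_of_forall_ne {c : Finset V → Finset V → Finset V → ℤ} {σ L A : Finset V}
    (hA : A ⊆ σ \ L) (h : ∀ A' ⊆ σ \ L, A' ≠ A → CubeFormula c σ L A') : CubeFormula c σ L A := by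
  have h1 := sum_ite_eq_initVertex σ L
  have h2 : ∑ A ∈ (σ \ L).powerset, ∑ x ∈ σ \ L,
      facetSign L A x * cubeCoeff c σ (insert x L) (A.erase x) = 0 := by
    rw [Finset.sum_comm]
    exact Finset.sum_eq_zero fun x hx => sum_facetSign_mul_eq_zero hx _
  rw [← Finset.add_sum_erase _ _ (Finset.mem_powerset.2 hA)] at h1 h2
  have h3 := Finset.sum_congr rfl fun A' (hA' : A' ∈ (σ \ L).powerset.erase A) =>
    h A' (Finset.mem_powerset.1 (Finset.mem_of_mem_erase hA')) (Finset.ne_of_mem_erase hA')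
  rw [h3] at h2
  rw [CubeFormula]
  linarith

theorem IsLocalSolution.sum_augmentation [Fintype V] {c : Finset V → Finset V → Finset V → ℤ}
    {σ : Finset V} (h : IsLocalSolution c 0 σ) (hσ : σ.Nonempty) :
    ∑ x ∈ σ, c σ {x} σ = 1 := by
  induction σ using Finset.strongInduction with
  | H σ ih =>
  obtain ⟨v, hv⟩ := hσ
  by_cases hsing : σ = {v}
  · subst hsing
    simpa using h.normalized rfl v (by simp)
  set τ := σ.erase v with hτ
  have hτσ : τ ⊆ σ := Finset.erase_subset _ _
  have hτne : τ.Nonempty := by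
    rw [Finset.nonempty_iff_ne_empty]
    intro h0
    exact hsing (by rw [← Finset.insert_erase hv, ← hτ, h0]; rfl)
  have hih := ih τ (Finset.erase_ssubset hv) (h.mono hτσ) hτne
  -- In degree zero the right-hand side lives only where a factor is empty, so it vanishes at the
  -- simplices used below.
  have hmodel : ∀ X Y : Finset V, X ∪ Y ⊆ σ → model 0 ∅ σ X Y + (-1) ^ 0 *
      ((-1) ^ ((X.card - 1) * (Y.card - 1)) * model 0 ∅ σ Y X) = 0 ∨ X = ∅ ∨ Y = ∅ := by
    intro X Y _
    have key : ∀ X Y : Finset V, model 0 ∅ σ X Y ≠ 0 → X = ∅ := by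
      intro X Y h0
      obtain ⟨h1, h2, h3⟩ := model_ne_zero h0
      rw [Finset.card_eq_zero] at h2
      rw [h2] at h3
      have h4 : initVertex ∅ σ (∅ : Finset V) = ∅ := by
        ext a; simp [mem_initVertex, EvenGap]
      rw [h4] at h3
      rw [← Finset.sdiff_union_inter X Y, h2, h3, Finset.union_empty]
    by_cases hX : model 0 ∅ σ X Y = 0
    · by_cases hY : model 0 ∅ σ Y X = 0
      · left; simp [hX, hY]
      · right; right; exact key _ _ hY
    · right; left; exact key _ _ hX
  -- This is the formula at {x} ⊗ τ. Summing it over `x` applies the augmentation to the first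
  -- factor and compares the claim on `σ` with the claim on `τ`.
  have heq : ∀ x ∈ σ, ∑ y ∈ ({x} : Finset V)ᶜ, (-1) ^ below {x} y * c σ {y, x} τ +
      (-1) ^ below τ v * c σ {x} σ = (-1) ^ below σ v * c τ {x} τ := by
    intro x hx
    have hf := h.formula σ subset_rfl ⟨v, hv⟩ {x} (by simpa using hx) (by simp) τ hτσ hτne
    rw [CoeffFormula] at hf
    have hr := (hmodel {x} τ (Finset.union_subset (by simpa using hx) hτσ)).resolve_right
      (by simp [hτne.ne_empty])
    rw [hr] at hf
    have e1 : ∑ y ∈ τᶜ, (-1) ^ below τ y * c σ {x} (insert y τ) =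
        (-1) ^ below τ v * c σ {x} σ := by
      rw [Finset.sum_eq_single_of_mem v (by simp [hτ])]
      · rw [hτ, Finset.insert_erase hv]
      · intro y hy hyv
        by_contra h0
        have := (h.subset σ subset_rfl _ _ (right_ne_zero_of_mul h0)).2 (Finset.mem_insert_self _ _)
        exact Finset.mem_compl.1 hy (Finset.mem_erase.2 ⟨hyv, this⟩)
    have e2 : ∑ w ∈ σ, (-1) ^ below σ w * c (σ.erase w) {x} τ =
        (-1) ^ below σ v * c τ {x} τ := by
      rw [Finset.sum_eq_single_of_mem v hv]
      intro w hw hwv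
      by_contra h0
      have := (h.subset _ (Finset.erase_subset _ _) _ _ (right_ne_zero_of_mul h0)).2
        (Finset.mem_erase.2 ⟨hwv, hw⟩)
      simp at this
    rw [e1, e2] at hf
    simp only [Finset.card_singleton, Nat.sub_self, pow_zero, one_mul] at hf
    linarith
  -- The augmentation of a boundary is zero: each edge {x, y} is counted twice, with opposite signs.
  have hanti : ∑ x ∈ σ, ∑ y ∈ ({x} : Finset V)ᶜ, (-1) ^ below {x} y * c σ {y, x} τ = 0 := by
    have e1 : ∀ x ∈ σ, ∑ y ∈ ({x} : Finset V)ᶜ, (-1) ^ below {x} y * c σ {y, x} τ =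
        ∑ y ∈ σ, if x = y then 0 else (-1) ^ below {x} y * c σ {y, x} τ := by
      intro x hx
      rw [← Finset.sum_filter_add_sum_filter_not σ (x = ·), Finset.sum_eq_zero (s := σ.filter _),
        zero_add]
      · symm
        apply Finset.sum_subset_zero_on_sdiff
        · intro y hy
          simp only [Finset.mem_filter, Finset.mem_compl, Finset.mem_singleton] at hy ⊢
          exact fun h => hy.2 h.symm
        · intro y hy
          simp only [Finset.mem_sdiff, Finset.mem_filter, Finset.mem_compl,
            Finset.mem_singleton, not_and, not_not] at hy
          by_contra h0
          have := (h.subset σ subset_rfl _ _ (right_ne_zero_of_mul h0)).1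
            (Finset.mem_insert_self _ _)
          exact hy.1 (hy.2 this).symm
        · intro y hy
          rw [if_neg (Finset.mem_filter.1 hy).2]
      · intro y hy
        rw [if_pos (Finset.mem_filter.1 hy).2]
    rw [Finset.sum_congr rfl e1]
    have e2 : ∀ x y, (if x = y then 0 else (-1) ^ below {x} y * c σ {y, x} τ) =
        -(if y = x then 0 else (-1) ^ below {y} x * c σ {x, y} τ) := by
      intro x y
      by_cases hxy : x = y
      · simp [hxy]
      · rw [if_neg hxy, if_neg (Ne.symm hxy), Finset.pair_comm]
        rcases lt_or_gt_of_ne hxy with h1 | h1 <;>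
          simp [below, Finset.filter_singleton, h1, h1.not_gt]
    have e3 := Finset.sum_comm (s := σ) (t := σ)
      (f := fun x y => if x = y then 0 else (-1) ^ below {x} y * c σ {y, x} τ)
    have e4 : ∑ x ∈ σ, ∑ y ∈ σ, (if x = y then 0 else (-1) ^ below {x} y * c σ {y, x} τ) =
        -∑ x ∈ σ, ∑ y ∈ σ, (if y = x then 0 else (-1) ^ below {y} x * c σ {x, y} τ) := by
      rw [← Finset.sum_neg_distrib]
      refine Finset.sum_congr rfl fun x _ => ?_
      rw [← Finset.sum_neg_distrib]
      exact Finset.sum_congr rfl fun y _ => e2 x y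
    linarith
  have hsum := Finset.sum_congr rfl heq
  rw [Finset.sum_add_distrib, hanti, ← Finset.mul_sum, ← Finset.mul_sum, zero_add] at hsum
  have hlast : ∑ x ∈ σ, c τ {x} τ = 1 := by
    rw [← hih]
    symm
    apply Finset.sum_subset hτσ
    intro x _ hx
    by_contra h0
    exact hx ((h.subset τ hτσ _ _ h0).1 (by simp))
  rw [hlast, show below τ v = below σ v from below_erase_self σ v] at hsum
  exact mul_left_cancel₀ (pow_ne_zero _ (by norm_num)) hsum

/-- The cubical form of the homotopy formula holds at all facets. -/
theorem IsLocalSolution.cubeFormula [Fintype V] {c : Finset V → Finset V → Finset V → ℤ} {i : ℕ}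
    {σ : Finset V} (h : IsLocalSolution c i σ) (hσ : σ.Nonempty) {L A : Finset V} (hLσ : L ⊆ σ)
    (hL : L.card = i) (hA : A ⊆ σ \ L) : CubeFormula c σ L A := by
  have main : ∀ A ⊆ σ \ L, (L ∪ A).Nonempty → (σ \ A).Nonempty → CubeFormula c σ L A := by
    intro A hA hX hY
    rw [← coeffFormula_iff_cubeFormula h.subset hLσ hL hA hX hY]
    exact h.formula σ subset_rfl hσ _
      (Finset.union_subset hLσ (hA.trans Finset.sdiff_subset)) hX _ Finset.sdiff_subset hY
  rcases L.eq_empty_or_nonempty with rfl | hLne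
  · simp only [Finset.card_empty] at hL
    subst hL
    simp only [Finset.sdiff_empty, Finset.empty_union] at main hA
    -- With `L = ∅` the facets `A = ∅` and `A = σ` have an empty factor and are invisible in the
    -- coefficients. The first is supplied by the augmentation, hence by the normalisation; the
    -- second then follows from all the others.
    have hempty : CubeFormula c σ ∅ ∅ := by
      have h0 : initVertex ∅ σ (∅ : Finset V) = ∅ := by ext a; simp [mem_initVertex, EvenGap]
      rw [CubeFormula, h0, Finset.sdiff_empty, Finset.empty_union, Finset.sdiff_empty,
        if_neg hσ.ne_empty, if_pos rfl, sub_zero, ← h.sum_augmentation hσ]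
      refine Finset.sum_congr rfl fun x hx => ?_
      simp [facetSign, EvenGap, cubeCoeff, signExp, Finset.filter_singleton]
    by_cases hAe : A = ∅
    · rw [hAe]; exact hempty
    have hother : ∀ A' ⊆ σ, A' ≠ σ → CubeFormula c σ ∅ A' := by
      intro A' hA' hne
      by_cases hA'e : A' = ∅
      · rw [hA'e]; exact hempty
      · exact main A' hA' (Finset.nonempty_iff_ne_empty.2 hA'e)
          (Finset.sdiff_nonempty.2 fun h => hne (hA'.antisymm h))
    by_cases hAσ : A = σ
    · rw [hAσ]
      refine cubeFormula_of_forall_ne (by simp) fun A' hA' hne => hother A' (by simpa using hA') hne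
    · exact hother A hA hAσ
  · refine main A hA (hLne.mono Finset.subset_union_left) (hLne.mono fun x hx => ?_)
    exact Finset.mem_sdiff.2 ⟨hLσ hx, fun h => (Finset.mem_sdiff.1 (hA h)).2 hx⟩

/-- The coefficients of the cubes with generating vectors `L` add up to one. -/
theorem IsLocalSolution.sum_cubeCoeff [Fintype V] {c : Finset V → Finset V → Finset V → ℤ} {i : ℕ}
    {σ : Finset V} (h : IsLocalSolution c i σ) {L : Finset V} (hLσ : L ⊆ σ)
    (hL : L.card = i + 1) : ∑ A ∈ (σ \ L).powerset, cubeCoeff c σ L A = 1 := by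
  classical
  obtain ⟨l, hl⟩ : L.Nonempty := Finset.card_pos.1 (by omega)
  set L' := L.erase l with hL'
  have hL'σ : L' ⊆ σ := (Finset.erase_subset _ _).trans hLσ
  have hcard : L'.card = i := by rw [hL', Finset.card_erase_of_mem hl]; omega
  have hlL' : l ∉ L' := Finset.notMem_erase _ _
  have hins : insert l L' = L := Finset.insert_erase hl
  have hlS : l ∈ σ \ L' := Finset.mem_sdiff.2 ⟨hLσ hl, hlL'⟩
  have hS : (σ \ L').erase l = σ \ L := by rw [← hins]; ext a; grind
  -- The weight selects the facets agreeing with the initial facet in coordinate `l`. It is constant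
  -- along every direction `x ≠ l`, so those directions cancel, while each cube with directions `L`
  -- has exactly one such facet in direction `l`. The initial facet is counted and the final one is
  -- not.
  have hsum := Finset.sum_congr rfl fun A (hA : A ∈ (σ \ L').powerset) =>
    congrArg (fun z : ℤ => (if l ∈ A ↔ EvenGap L' l then (0 : ℤ) else 1) * z)
      (h.cubeFormula ⟨l, hLσ hl⟩ hL'σ hcard (Finset.mem_powerset.1 hA))
  simp only [Finset.mul_sum] at hsum
  rw [Finset.sum_comm, ← Finset.add_sum_erase _ _ hlS, Finset.sum_eq_zero (s := (σ \ L').erase l),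
    add_zero] at hsum
  · rw [hins, sum_powerset_eq_sum_powerset_erase hlS, hS] at hsum
    have hl' : ∀ A ∈ (σ \ L).powerset, ((if l ∈ A ↔ EvenGap L' l then (0 : ℤ) else 1) *
        (facetSign L' A l * cubeCoeff c σ L (A.erase l)) +
        (if l ∈ insert l A ↔ EvenGap L' l then (0 : ℤ) else 1) *
        (facetSign L' (insert l A) l * cubeCoeff c σ L ((insert l A).erase l))) =
        cubeCoeff c σ L A := by
      intro A hA
      have hlA : l ∉ A := fun h => (Finset.mem_sdiff.1 (Finset.mem_powerset.1 hA h)).2 hl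
      by_cases hp : EvenGap L' l <;> simp [facetSign, hp, hlA]
    rw [Finset.sum_congr rfl hl'] at hsum
    rw [hsum, Finset.sum_eq_single_of_mem (initVertex ∅ σ L')
      (Finset.mem_powerset.2 initVertex_subset)]
    · have h1 : ¬ (l ∈ initVertex ∅ σ L' ↔ EvenGap L' l) := by
        rw [mem_initVertex]
        simp only [Set.mem_empty_iff_false, false_iff]
        have := Finset.mem_sdiff.1 hlS
        tauto
      have h2 : σ \ (L' ∪ initVertex ∅ σ L') ≠ initVertex ∅ σ L' := by
        intro h2
        have : l ∈ σ \ (L' ∪ initVertex ∅ σ L') ↔ l ∈ initVertex ∅ σ L' := by rw [h2]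
        have h3 := Finset.mem_sdiff.1 hlS
        rw [Finset.mem_sdiff, Finset.mem_union] at this
        tauto
      rw [if_neg h1, if_pos rfl, if_neg h2]
      norm_num
    · intro A hA hne
      rw [if_neg hne]
      by_cases h2 : σ \ (L' ∪ A) = initVertex ∅ σ L'
      · have h1 : l ∈ A ↔ EvenGap L' l := ?_
        · rw [if_pos h1, zero_mul]
        have h3 := Finset.mem_sdiff.1 hlS
        have : l ∈ σ \ (L' ∪ A) ↔ l ∈ initVertex ∅ σ L' := by rw [h2]
        rw [Finset.mem_sdiff, Finset.mem_union, mem_initVertex] at this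
        simp only [Set.mem_empty_iff_false, false_iff] at this
        tauto
      · rw [if_neg h2]; simp
  · intro x hx
    rw [Finset.mem_erase] at hx
    have hlx : ∀ A : Finset V, l ∈ A ↔ l ∈ A.erase x := fun A => by simp [Ne.symm hx.1]
    have := sum_facetSign_mul_eq_zero (L := L') hx.2 (fun A =>
      (if l ∈ A ↔ EvenGap L' l then (0 : ℤ) else 1) * cubeCoeff c σ (insert x L') A)
    refine (Finset.sum_congr rfl fun A _ => ?_).trans this
    simp only [← hlx]
    ring

end

section

variable {V : Type*} [LinearOrder V] [Fintype V]

/-! ### Solutions with one term for each generating set -/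

/-- The coefficients `c` on `σ` are supported on cubes of dimension `i + 1`, with at most one cube
for each set of generating vectors. -/
structure IsMinimalAt (c : Finset V → Finset V → Finset V → ℤ) (i : ℕ) (σ : Finset V) : Prop where
  full : ∀ X Y, c σ X Y ≠ 0 → X ∪ Y = σ ∧ (X ∩ Y).card = i + 1
  unique : ∀ X Y X' Y', c σ X Y ≠ 0 → c σ X' Y' ≠ 0 → X ∩ Y = X' ∩ Y' → X = X' ∧ Y = Y'

open Classical in
/-- The initial vertex of the cube with generating vectors `L` in a minimal solution. -/
def cubeVertex (c : Finset V → Finset V → Finset V → ℤ) (σ L : Finset V) : Finset V :=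
  (σ \ L).filter fun a => ∃ X Y, c σ X Y ≠ 0 ∧ X ∩ Y = L ∧ a ∈ X

variable {c : Finset V → Finset V → Finset V → ℤ} {i : ℕ} {σ L : Finset V}

theorem union_inter_sdiff_eq {A : Finset V} (hL : L ⊆ σ) (hA : A ⊆ σ \ L) :
    (L ∪ A) ∩ (σ \ A) = L := by
  ext a; have := @hA a; have := @hL a; grind

theorem IsMinimalAt.cubeVertex_eq (hm : IsMinimalAt c i σ) {X Y : Finset V}
    (h : c σ X Y ≠ 0) : cubeVertex c σ (X ∩ Y) = X \ Y := by
  have hf := hm.full X Y h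
  ext a
  have hσ : a ∈ σ ↔ a ∈ X ∨ a ∈ Y := by rw [← hf.1, Finset.mem_union]
  simp only [cubeVertex, Finset.mem_filter, Finset.mem_sdiff, hσ, Finset.mem_inter]
  constructor
  · rintro ⟨h1, X', Y', h2, h3, h4⟩
    obtain ⟨rfl, rfl⟩ := hm.unique _ _ _ _ h2 h h3
    tauto
  · rintro ⟨h1, h2⟩
    exact ⟨by tauto, X, Y, h, rfl, h1⟩

/-- At most one cube has directions `L` and a nonzero coefficient, and the coefficients for `L` add
up to one. -/
theorem IsMinimalAt.cubeCoeff_eq (hm : IsMinimalAt c i σ) (hs : IsLocalSolution c i σ)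
    (hL : L ⊆ σ) (hcard : L.card = i + 1) {A : Finset V} (hA : A ⊆ σ \ L) :
    cubeCoeff c σ L A = if A = cubeVertex c σ L then 1 else 0 := by
  have hne : ∀ A ⊆ σ \ L, cubeCoeff c σ L A ≠ 0 → A = cubeVertex c σ L := by
    intro A hA h
    have h1 := hm.cubeVertex_eq (right_ne_zero_of_mul h)
    rw [union_inter_sdiff_eq hL hA] at h1
    rw [h1]
    ext a; have := @hA a; have := @hL a; grind
  have hsum := hs.sum_cubeCoeff hL hcard
  rw [Finset.sum_eq_single (cubeVertex c σ L)] at hsum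
  · split_ifs with h
    · rw [h, hsum]
    · by_contra h0
      exact h (hne A hA h0)
  · intro A hA hne'
    by_contra h0
    exact hne' (hne A (Finset.mem_powerset.1 hA) h0)
  · intro h
    exact absurd (Finset.mem_powerset.2 (Finset.filter_subset _ _)) h

theorem IsMinimalAt.coeff_cubeVertex_ne_zero (hm : IsMinimalAt c i σ) (hs : IsLocalSolution c i σ)
    (hL : L ⊆ σ) (hcard : L.card = i + 1) :
    c σ (L ∪ cubeVertex c σ L) (σ \ cubeVertex c σ L) ≠ 0 := by
  have h := hm.cubeCoeff_eq hs hL hcard (A := cubeVertex c σ L) (Finset.filter_subset _ _)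
  rw [if_pos rfl] at h
  intro h0
  rw [cubeCoeff, h0, mul_zero] at h
  exact zero_ne_one h

/-- Let X ⊗ Y be the term for `L` on the face without `w`. At X ⊗ Y the formula on `σ` has the
nonzero contribution of that face, which can be cancelled only by a term obtained by adding `w` to
one factor. Such a term has the same intersection `L`, so it is the cube for `L` on `σ`. -/
theorem cubeVertex_erase (hs : IsLocalSolution c i σ) (hm : IsMinimalAt c i σ) {w : V}
    (hm' : IsMinimalAt c i (σ.erase w)) (hw : w ∈ σ) (hL : L ⊆ σ.erase w)
    (hcard : L.card = i + 1) :
    (cubeVertex c σ L).erase w = cubeVertex c (σ.erase w) L := by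
  set τ := σ.erase w with hτ
  have hτσ : τ ⊆ σ := Finset.erase_subset _ _
  set A := cubeVertex c τ L with hA
  have hAτ : A ⊆ τ \ L := Finset.filter_subset _ _
  have hLne : L.Nonempty := Finset.card_pos.1 (by omega)
  have hc := hm'.coeff_cubeVertex_ne_zero (hs.mono hτσ) hL hcard
  rw [← hA] at hc
  set X := L ∪ A with hX
  set Y := τ \ A with hY
  have hXY : X ∪ Y = τ := (hm'.full X Y hc).1
  have hXYL : X ∩ Y = L := union_inter_sdiff_eq hL hAτ
  have hwτ : w ∉ τ := Finset.notMem_erase _ _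
  have hwX : w ∉ X := fun h => hwτ (hXY ▸ Finset.mem_union_left _ h)
  have hwY : w ∉ Y := fun h => hwτ (hXY ▸ Finset.mem_union_right _ h)
  have hwA : w ∉ A := fun h => hwX (Finset.mem_union_right _ h)
  have hXne : X.Nonempty := hLne.mono Finset.subset_union_left
  have hYne : Y.Nonempty := by
    refine hLne.mono ?_
    rw [← hXYL]; exact Finset.inter_subset_right
  have hXτ : X ⊆ τ := hXY ▸ Finset.subset_union_left
  have hYτ : Y ⊆ τ := hXY ▸ Finset.subset_union_right
  have key : c σ (insert w X) Y ≠ 0 ∨ c σ X (insert w Y) ≠ 0 := by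
    by_contra hcon
    rw [not_or, not_not, not_not] at hcon
    have hf := hs.formula σ subset_rfl ⟨w, hw⟩ X (hXτ.trans hτσ) hXne Y (hYτ.trans hτσ) hYne
    rw [CoeffFormula, Finset.sum_eq_zero, Finset.sum_eq_zero,
      Finset.sum_eq_single_of_mem w hw] at hf
    · have hne : X ∪ Y ≠ σ := by rw [hXY]; exact fun h => hwτ (h ▸ hw)
      have r1 : model i ∅ σ X Y = 0 := if_neg fun h => hne h.1
      have r2 : model i ∅ σ Y X = 0 := if_neg fun h => hne (Finset.union_comm X Y ▸ h.1)
      rw [r1, r2] at hf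
      simp only [mul_zero, zero_add, zero_sub, neg_eq_zero, mul_eq_zero] at hf
      rcases hf with hf | hf | hf
      · exact pow_ne_zero _ (by norm_num) hf
      · exact pow_ne_zero _ (by norm_num) hf
      · exact hc hf
    · intro x hx hxw
      by_contra h0
      have h1 := hs.subset _ (Finset.erase_subset x σ) _ _ (right_ne_zero_of_mul h0)
      have h2 : x ∈ X ∪ Y := by rw [hXY]; exact Finset.mem_erase.2 ⟨hxw, hx⟩
      exact Finset.notMem_erase x σ (Finset.union_subset h1.1 h1.2 h2)
    · intro y hy
      by_cases hyw : y = w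
      · rw [hyw, hcon.2, mul_zero]
      by_contra h0
      have h1 := (hm.full _ _ (right_ne_zero_of_mul h0)).1
      have h2 : w ∈ X ∪ insert y Y := h1 ▸ hw
      simp only [Finset.mem_union, Finset.mem_insert, hwX, hwY, Ne.symm hyw, or_self] at h2
    · intro y hy
      by_cases hyw : y = w
      · rw [hyw, hcon.1, mul_zero]
      by_contra h0
      have h1 := (hm.full _ _ (right_ne_zero_of_mul h0)).1
      have h2 : w ∈ insert y X ∪ Y := h1 ▸ hw
      simp only [Finset.mem_union, Finset.mem_insert, hwX, hwY, Ne.symm hyw, or_self] at h2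
  have hXA : X \ Y = A := by
    ext a; have := @hAτ a; have := @hL a; grind
  rcases key with h | h
  · have h1 := hm.cubeVertex_eq h
    rw [Finset.insert_inter_of_notMem hwY, hXYL, Finset.insert_sdiff_of_notMem _ hwY, hXA] at h1
    rw [h1, Finset.erase_insert hwA]
  · have h1 := hm.cubeVertex_eq h
    rw [Finset.inter_insert_of_notMem hwX, hXYL, Finset.sdiff_insert_of_notMem hwX, hXA] at h1
    rw [h1, Finset.erase_eq_of_notMem hwA]

theorem mem_cubeVertex_iff (hs : IsLocalSolution c i σ) (hm : ∀ τ ⊆ σ, IsMinimalAt c i τ)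
    (hL : L ⊆ σ) (hcard : L.card = i + 1) {a : V} (ha : a ∈ σ) :
    a ∈ cubeVertex c σ L ↔ a ∈ cubeVertex c (insert a L) L := by
  induction σ using Finset.strongInduction with
  | H σ ih =>
  have hsub : insert a L ⊆ σ := Finset.insert_subset ha hL
  by_cases heq : insert a L = σ
  · rw [heq]
  obtain ⟨w, hw, hw'⟩ := Finset.exists_of_ssubset (hsub.ssubset_of_ne heq)
  have haw : a ≠ w := by rintro rfl; simp at hw'
  have hLw : L ⊆ σ.erase w := fun x hx => Finset.mem_erase.2
    ⟨by rintro rfl; exact hw' (Finset.mem_insert_of_mem hx), hL hx⟩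
  have hτ := Finset.erase_subset w σ
  rw [← ih _ (Finset.erase_ssubset hw) (hs.mono hτ) (fun ρ hρ => hm ρ (hρ.trans hτ)) hLw
    (Finset.mem_erase.2 ⟨haw, ha⟩), ← cubeVertex_erase hs (hm σ subset_rfl) (hm _ hτ) hw hLw hcard]
  simp [haw]

/-- Among the facets with generating vectors `L`, each of the two boundary facets lies in some cube. -/
theorem exists_erase_eq_cubeVertex (hs : IsLocalSolution c i σ) (hm : IsMinimalAt c i σ)
    (hL : L ⊆ σ) (hcard : L.card = i) (hne : (σ \ L).Nonempty) {A : Finset V} (hA : A ⊆ σ \ L)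
    (hA' : A = initVertex ∅ σ L ∨ σ \ (L ∪ A) = initVertex ∅ σ L) :
    ∃ x ∈ σ \ L, A.erase x = cubeVertex c σ (insert x L) := by
  by_contra hcon
  push Not at hcon
  have hf := hs.cubeFormula (hne.mono Finset.sdiff_subset) hL hcard hA
  rw [CubeFormula, Finset.sum_eq_zero] at hf
  · have hex : ¬ (A = initVertex ∅ σ L ∧ σ \ (L ∪ A) = initVertex ∅ σ L) := by
      rintro ⟨h1, h2⟩
      obtain ⟨x, hx⟩ := hne
      have h3 : x ∈ σ \ (L ∪ A) ↔ x ∈ A := by rw [h2, h1]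
      rw [Finset.mem_sdiff] at hx
      rw [Finset.mem_sdiff, Finset.mem_union] at h3
      tauto
    rcases hA' with h | h
    · rw [if_pos h, if_neg fun h' => hex ⟨h, h'⟩] at hf
      norm_num at hf
    · rw [if_pos h, if_neg fun h' => hex ⟨h', h⟩] at hf
      norm_num at hf
  · intro x hx
    have hx' := Finset.mem_sdiff.1 hx
    rw [hm.cubeCoeff_eq hs (Finset.insert_subset hx'.1 hL)
      (by rw [Finset.card_insert_of_notMem hx'.2, hcard]), if_neg (hcon x hx), mul_zero]
    intro a ha
    have := @hA a
    simp only [Finset.mem_erase, Finset.mem_sdiff, Finset.mem_insert] at ha this ⊢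
    tauto

/-! ### The inversion set of a minimal solution and its consistency -/

/-- The set of inversions of a minimal solution. -/
def inversionSet (c : Finset V → Finset V → Finset V → ℤ) (F : Set (Finset V)) (i : ℕ) :
    Set (Finset V) :=
  {M | M ∈ F ∧ M.card = i + 2 ∧
    ∃ a ∈ M, (a ∈ cubeVertex c M (M.erase a) ↔ EvenGap (M.erase a) a)}

/-- This makes membership in the inversion set independent of the chosen vertex. With only two
directions outside L = M \ {a, b}, the cubes form a path of two steps from the initial to the final
facet, and the order of the two steps decides both conditions. -/
theorem cubeVertex_evenGap_iff {M : Finset V} (hs : IsLocalSolution c i M)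
    (hm : IsMinimalAt c i M) (hM : M.card = i + 2) {a b : V} (ha : a ∈ M) (hb : b ∈ M) :
    (a ∈ cubeVertex c M (M.erase a) ↔ EvenGap (M.erase a) a) ↔
      (b ∈ cubeVertex c M (M.erase b) ↔ EvenGap (M.erase b) b) := by
  by_cases hab : a = b
  · rw [hab]
  set L := (M.erase a).erase b with hL
  have hbMa : b ∈ M.erase a := Finset.mem_erase.2 ⟨Ne.symm hab, hb⟩
  have haL : a ∉ L := by simp [hL]
  have hbL : b ∉ L := by simp [hL]
  have hLM : L ⊆ M := (Finset.erase_subset _ _).trans (Finset.erase_subset _ _)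
  have hLcard : L.card = i := by
    rw [hL, Finset.card_erase_of_mem hbMa, Finset.card_erase_of_mem ha]; omega
  have hS : M \ L = {a, b} := by rw [hL]; ext x; grind
  have hSmem : ∀ x, x ∈ M \ L ↔ x = a ∨ x = b := fun x => by rw [hS]; simp
  have ea : M.erase a = insert b L := (Finset.insert_erase hbMa).symm
  have eb : M.erase b = insert a L := by rw [hL]; ext x; grind
  have hne : (M \ L).Nonempty := by rw [hS]; simp
  set O := initVertex ∅ M L with hO
  have hOsub : O ⊆ M \ L := initVertex_subset
  have hOmem : ∀ x, x ∈ M \ L → (x ∈ O ↔ ¬ EvenGap L x) := by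
    intro x hx
    rw [hO, mem_initVertex]
    rw [Finset.mem_sdiff] at hx
    simp only [Set.mem_empty_iff_false, false_iff]
    tauto
  obtain ⟨x, hx, hxO⟩ := exists_erase_eq_cubeVertex hs hm hLM hLcard hne hOsub (Or.inl rfl)
  obtain ⟨y, hy, hyO⟩ := exists_erase_eq_cubeVertex hs hm hLM hLcard hne
    (A := (M \ L) \ O) Finset.sdiff_subset (Or.inr (by ext z; have := @hOsub z; grind))
  -- One cube cannot contain both facets: they differ in the other direction as well.
  have hxy : x ≠ y := by
    rintro rfl
    rw [← hyO] at hxO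
    obtain ⟨z, hz, hzx⟩ : ∃ z ∈ M \ L, z ≠ x := by
      rcases (hSmem x).1 hx with rfl | rfl
      · exact ⟨b, (hSmem b).2 (Or.inr rfl), Ne.symm hab⟩
      · exact ⟨a, (hSmem a).2 (Or.inl rfl), hab⟩
    have : z ∈ O.erase x ↔ z ∈ ((M \ L) \ O).erase x := by rw [hxO]
    simp only [Finset.mem_erase, Finset.mem_sdiff (s := M \ L), hzx, hz, ne_eq,
      not_false_eq_true, true_and] at this
    tauto
  have hy' : y ∈ cubeVertex c M (insert x L) ↔ ¬ EvenGap L y := by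
    rw [← hxO, Finset.mem_erase, hOmem y hy]
    exact and_iff_right (Ne.symm hxy)
  have hx' : x ∈ cubeVertex c M (insert y L) ↔ EvenGap L x := by
    rw [← hyO, Finset.mem_erase, Finset.mem_sdiff (s := M \ L), hOmem x hx, not_not]
    simp [hxy, hx]
  have hxL : x ∉ L := (Finset.mem_sdiff.1 hx).2
  have hyL : y ∉ L := (Finset.mem_sdiff.1 hy).2
  have hlt : ¬ x < y ↔ y < x := by
    rw [not_lt]; exact ⟨fun h => lt_of_le_of_ne h (Ne.symm hxy), le_of_lt⟩
  have main : (y ∈ cubeVertex c M (insert x L) ↔ EvenGap (insert x L) y) ↔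
      (x ∈ cubeVertex c M (insert y L) ↔ EvenGap (insert y L) x) := by
    rw [hx', hy', evenGap_insert hxL, evenGap_insert hyL, hlt]
    generalize (y < x) = p
    generalize EvenGap L x = q
    generalize EvenGap L y = r
    by_cases p <;> by_cases q <;> by_cases r <;> simp_all
  rw [ea, eb]
  rcases (hSmem x).1 hx with rfl | rfl <;> rcases (hSmem y).1 hy with rfl | rfl
  · exact absurd rfl hxy
  · exact main.symm
  · exact main
  · exact absurd rfl hxy

variable {F : Set (Finset V)}

theorem cubeVertex_eq_initVertex (hF : ∀ M ⊆ σ, M.Nonempty → M ∈ F)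
    (hs : IsLocalSolution c i σ) (hm : ∀ τ ⊆ σ, IsMinimalAt c i τ) (hL : L ⊆ σ)
    (hcard : L.card = i + 1) : cubeVertex c σ L = initVertex (inversionSet c F i) σ L := by
  ext a
  rw [mem_initVertex]
  by_cases ha : a ∈ σ ∧ a ∉ L
  · obtain ⟨haσ, haL⟩ := ha
    rw [mem_cubeVertex_iff hs hm hL hcard haσ]
    have hsub : insert a L ⊆ σ := Finset.insert_subset haσ hL
    have hM : (insert a L).card = i + 2 := by rw [Finset.card_insert_of_notMem haL, hcard]
    have : insert a L ∈ inversionSet c F i ↔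
        (a ∈ cubeVertex c (insert a L) L ↔ EvenGap L a) := by
      constructor
      · rintro ⟨-, -, b, hb, h⟩
        rw [cubeVertex_evenGap_iff (hs.mono hsub) (hm _ hsub) hM hb (Finset.mem_insert_self a L),
          Finset.erase_insert haL] at h
        exact h
      · intro h
        refine ⟨hF _ hsub (Finset.insert_nonempty _ _), hM, a, Finset.mem_insert_self _ _, ?_⟩
        rwa [Finset.erase_insert haL]
    rw [this]
    simp only [haσ, haL, not_false_eq_true, and_self, true_and]
    tauto
  · refine iff_of_false (fun h => ha ?_) fun h => ha h.1
    exact Finset.mem_sdiff.1 (Finset.filter_subset _ _ h)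

/-- The initial facet lies in some cube. In the coordinates measured from this facet, that cube's
direction has an empty set of predecessors. -/
theorem exists_not_precedes (hF : ∀ M ⊆ σ, M.Nonempty → M ∈ F)
    (hs : IsLocalSolution c i σ) (hm : ∀ τ ⊆ σ, IsMinimalAt c i τ) (hL : L ⊆ σ)
    (hcard : L.card = i) (hne : (σ \ L).Nonempty) :
    ∃ x ∈ σ \ L, ∀ y ∈ σ \ L, ¬ Precedes (inversionSet c F i) L y x := by
  classical
  obtain ⟨x, hx, h⟩ := exists_erase_eq_cubeVertex hs (hm σ subset_rfl) hL hcard hne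
    (initVertex_subset (U := ∅)) (Or.inl rfl)
  have hx' := Finset.mem_sdiff.1 hx
  rw [cubeVertex_eq_initVertex hF hs hm (Finset.insert_subset hx'.1 hL)
      (by rw [Finset.card_insert_of_notMem hx'.2, hcard]),
    erase_eq_initVertex_iff initVertex_subset hx'.2,
    (facetCoord_eq_empty initVertex_subset).2 rfl, Finset.erase_empty] at h
  refine ⟨x, hx, fun y hy hyx => ?_⟩
  have : y ∈ (∅ : Finset V) := by
    rw [h]; exact Finset.mem_filter.2 ⟨hy, hyx⟩
  simp at this

/-- Consistency says that the indicator function of `U` on the packet is monotone or antitone. A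
function on a linear order that is neither has a strict peak or valley on three points, excluded
here for a two-valued function. -/
theorem consistentAt_of_forall_lt_lt {U : Set (Finset V)} {M : Finset V}
    (h : ∀ x ∈ M, ∀ y ∈ M, ∀ z ∈ M, x < y → y < z → (M.erase x ∈ U ↔ M.erase z ∈ U) →
      (M.erase x ∈ U ↔ M.erase y ∈ U)) : ConsistentAt U M := by
  classical
  by_contra hcon
  rw [ConsistentAt, not_or] at hcon
  push Not at hcon
  obtain ⟨⟨a, ha, a', ha', haa', h1, h2⟩, b, hb, b', hb', hbb', h3, h4⟩ := hcon
  let f : M → ℕ := fun k => if M.erase k ∈ U then 1 else 0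
  have hmono : ¬ Monotone f := fun hf => by
    have := hf (show (⟨a, ha⟩ : M) ≤ ⟨a', ha'⟩ from haa'.le)
    simp [f, h1, h2] at this
  have hanti : ¬ Antitone f := fun hf => by
    have := hf (show (⟨b, hb⟩ : M) ≤ ⟨b', hb'⟩ from hbb'.le)
    simp [f, h3, h4] at this
  obtain ⟨x, y, z, hxy, hyz, hf⟩ := not_monotone_not_antitone_iff_exists_lt_lt.1 ⟨hmono, hanti⟩
  have := h x x.2 y y.2 z z.2 hxy hyz
  by_cases p1 : M.erase x ∈ U <;> by_cases p2 : M.erase y ∈ U <;> by_cases p3 : M.erase z ∈ U <;>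
    simp [f, p1, p2, p3] at hf this

theorem consistentAt_inversionSet {M : Finset V} (hF : ∀ M' ⊆ M, M'.Nonempty → M' ∈ F)
    (hs : IsLocalSolution c i M) (hm : ∀ τ ⊆ M, IsMinimalAt c i τ) (hM : M.card = i + 3) :
    ConsistentAt (inversionSet c F i) M := by
  apply consistentAt_of_forall_lt_lt
  intro x hx y hy z hz hxy hyz hxz
  by_contra hne
  have hxz' := hxy.trans hyz
  set L := ((M.erase x).erase y).erase z with hL
  have hmy : y ∈ M.erase x := Finset.mem_erase.2 ⟨hxy.ne', hy⟩
  have hmz : z ∈ (M.erase x).erase y := by simp [hz, hyz.ne', hxz'.ne']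
  have hcard : L.card = i := by
    rw [hL, Finset.card_erase_of_mem hmz, Finset.card_erase_of_mem hmy,
      Finset.card_erase_of_mem hx]
    omega
  have hLM : L ⊆ M := (Finset.erase_subset _ _).trans
    ((Finset.erase_subset _ _).trans (Finset.erase_subset _ _))
  have hS : ∀ w, w ∈ M \ L ↔ w = x ∨ w = y ∨ w = z := by
    intro w
    simp only [hL, Finset.mem_sdiff, Finset.mem_erase]
    constructor
    · tauto
    · rintro (rfl | rfl | rfl) <;> simp [hx, hy, hz]
  have ex : M.erase x = insert y (insert z L) := by rw [hL]; ext a; grind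
  have ey : M.erase y = insert x (insert z L) := by rw [hL]; ext a; grind
  have ez : M.erase z = insert x (insert y L) := by rw [hL]; ext a; grind
  -- A violation makes `Precedes` cyclic on x, y, z, so none of the three can be without a
  -- predecessor.
  obtain ⟨w, hw, hmin⟩ := exists_not_precedes hF hs hm hLM hcard ⟨x, (hS x).2 (Or.inl rfl)⟩
  have mx := hmin x ((hS x).2 (Or.inl rfl))
  have my := hmin y ((hS y).2 (Or.inr (Or.inl rfl)))
  have mz := hmin z ((hS z).2 (Or.inr (Or.inr rfl)))
  rw [ex, ez] at hxz
  rw [ex, ey] at hne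
  have cyx : insert y (insert x L) = insert x (insert y L) := Finset.insert_comm _ _ _
  have czx : insert z (insert x L) = insert x (insert z L) := Finset.insert_comm _ _ _
  have czy : insert z (insert y L) = insert y (insert z L) := Finset.insert_comm _ _ _
  rcases (hS w).1 hw with rfl | rfl | rfl
  · simp only [Precedes, cyx, czx, hxy, hxz', hxy.ne', hxz'.ne', ne_eq, not_false_eq_true,
      iff_true, true_and] at my mz
    exact hne (by rw [hxz]; exact iff_of_false my mz)
  · simp only [Precedes, czy, hxy.not_gt, hyz, hxy.ne, hyz.ne', ne_eq, not_false_eq_true,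
      iff_true, iff_false, true_and, not_not] at mx mz
    exact mz (hxz.2 mx)
  · simp only [Precedes, hxz'.not_gt, hyz.not_gt, hxz'.ne, hyz.ne, ne_eq, not_false_eq_true,
      iff_false, true_and, not_not] at mx my
    exact hne (iff_of_true my mx)

theorem coeff_eq_model (hF : ∀ M ⊆ σ, M.Nonempty → M ∈ F) (hs : IsLocalSolution c i σ)
    (hm : ∀ τ ⊆ σ, IsMinimalAt c i τ) (X Y : Finset V) :
    c σ X Y = model (i + 1) (inversionSet c F i) σ X Y := by
  have hmσ := hm σ subset_rfl
  by_cases hXY : X ∪ Y = σ ∧ (X ∩ Y).card = i + 1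
  · obtain ⟨h1, h2⟩ := hXY
    have hL : X ∩ Y ⊆ σ := by rw [← h1]; intro a; grind
    have hA : X \ Y ⊆ σ \ (X ∩ Y) := by rw [← h1]; intro a; grind
    have eX : X ∩ Y ∪ X \ Y = X := by ext a; grind
    have eY : σ \ (X \ Y) = Y := by rw [← h1]; ext a; grind
    have eB : σ \ X = Y \ X := by rw [← h1]; ext a; grind
    have h3 := hmσ.cubeCoeff_eq hs hL h2 hA
    rw [cubeCoeff, eX, eY, eB, cubeVertex_eq_initVertex hF hs hm hL h2] at h3
    rw [model]
    simp only [h1, h2, true_and]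
    split_ifs with h4
    · rw [if_pos h4] at h3
      have := neg_one_pow_mul_self (signExp σ.card (X ∩ Y) (X \ Y) (Y \ X))
      linear_combination (-1) ^ signExp σ.card (X ∩ Y) (X \ Y) (Y \ X) * h3 - c σ X Y * this
    · rw [if_neg h4] at h3
      exact (mul_eq_zero.1 h3).resolve_left (pow_ne_zero _ (by norm_num))
  · rw [model, if_neg fun h => hXY ⟨h.1, h.2.1⟩]
    by_contra h
    exact hXY (hmσ.full X Y h)

end

section

variable {V : Type*} [LinearOrder V] [Fintype V] {K : PreAbstractSimplicialComplex V}

/-! ### The retraction onto a simplex -/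

theorem sum_sum_eq_zero_of_antisymm {α : Type*} (S : Finset α) (f : α → α → ℤ)
    (h : ∀ x ∈ S, ∀ y ∈ S, f x y = -f y x) : ∑ x ∈ S, ∑ y ∈ S, f x y = 0 := by
  have h1 := Finset.sum_comm (s := S) (t := S) (f := f)
  have h2 : ∑ x ∈ S, ∑ y ∈ S, f x y = -∑ x ∈ S, ∑ y ∈ S, f y x := by
    rw [← Finset.sum_neg_distrib]
    refine Finset.sum_congr rfl fun x hx => ?_
    rw [← Finset.sum_neg_distrib]
    exact Finset.sum_congr rfl fun y hy => h x hx y hy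
  linarith

theorem chainCoeff_boundary_of_nonempty {s : Finset V} (hs : s.Nonempty) (a : Chains K) :
    chainCoeff K s (boundary K a) =
      ∑ x ∈ sᶜ, (-1) ^ below s x * chainCoeff K (insert x s) a := by
  by_cases h : s ∈ K.faces
  · exact chainCoeff_boundary h a
  · rw [chainCoeff_of_notMem h, Finset.sum_eq_zero]
    intro x _
    rw [chainCoeff_of_notMem fun h' => h (mem_faces_of_subset h' (Finset.subset_insert _ _) hs),
      mul_zero]

theorem chain_ext {a b : Chains K} (h : ∀ s ∈ K.faces, chainCoeff K s a = chainCoeff K s b) :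
    a = b := by
  ext σ
  have := h σ.1 σ.2
  rwa [chainCoeff_of_mem σ.2, chainCoeff_of_mem σ.2] at this

theorem boundary_boundary (a : Chains K) : boundary K (boundary K a) = 0 := by
  apply chain_ext
  intro s hs
  rw [chainCoeff_boundary hs, map_zero,
    ← sum_sum_eq_zero_of_antisymm sᶜ (fun x y => if x = y then 0 else
      (-1) ^ below s x * ((-1) ^ below (insert x s) y * chainCoeff K (insert y (insert x s)) a))]
  · refine Finset.sum_congr rfl fun x hx => ?_
    rw [chainCoeff_boundary_of_nonempty (Finset.insert_nonempty _ _), Finset.mul_sum]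
    have : (insert x s)ᶜ = sᶜ.erase x := by ext; simp
    rw [this, ← Finset.add_sum_erase sᶜ _ hx, if_pos rfl, zero_add]
    refine Finset.sum_congr rfl fun y hy => ?_
    rw [if_neg (Finset.ne_of_mem_erase hy).symm]
  · intro x hx y hy
    rw [Finset.mem_compl] at hx hy
    by_cases hxy : x = y
    · simp [hxy]
    rw [if_neg hxy, if_neg (Ne.symm hxy), below_insert hx, below_insert hy, Finset.insert_comm]
    rcases lt_or_gt_of_ne hxy with h | h <;> simp only [h, h.not_gt, if_true, if_false] <;> ring

/-- The augmentation. -/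
def augmentation (K : PreAbstractSimplicialComplex V) : Chains K →ₗ[ℤ] ℤ :=
  Finsupp.linearCombination ℤ fun σ : K.faces => if σ.1.card = 1 then (1 : ℤ) else 0

/-- The projection onto the chains on `σ`, which is not a chain map. -/
def projection (K : PreAbstractSimplicialComplex V) (σ : Finset V) : Chains K →ₗ[ℤ] Chains K :=
  Finsupp.linearCombination ℤ fun τ : K.faces => if τ.1 ⊆ σ then chain K τ.1 else 0

/-- The cone with apex `w`. -/
def cone (K : PreAbstractSimplicialComplex V) (w : V) : Chains K →ₗ[ℤ] Chains K :=
  Finsupp.linearCombination ℤ fun τ : K.faces =>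
    if w ∈ τ.1 then 0 else (-1 : ℤ) ^ below τ.1 w • chain K (insert w τ.1)

theorem augmentation_chain {s : Finset V} (hs : s ∈ K.faces) :
    augmentation K (chain K s) = if s.card = 1 then 1 else 0 := by
  rw [chain_of_mem hs, augmentation, Finsupp.linearCombination_single, one_smul]

theorem projection_chain {s : Finset V} (hs : s ∈ K.faces) (σ : Finset V) :
    projection K σ (chain K s) = if s ⊆ σ then chain K s else 0 := by
  conv_lhs => rw [chain_of_mem hs, projection, Finsupp.linearCombination_single, one_smul]

theorem projection_chain_of_subset {s σ : Finset V} (h : s ⊆ σ) :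
    projection K σ (chain K s) = chain K s := by
  by_cases hs : s ∈ K.faces
  · rw [projection_chain hs, if_pos h]
  · rw [chain_of_notMem hs, map_zero]

theorem cone_chain {s : Finset V} (hs : s ∈ K.faces) (w : V) :
    cone K w (chain K s) = if w ∈ s then 0 else (-1 : ℤ) ^ below s w • chain K (insert w s) := by
  rw [chain_of_mem hs, cone, Finsupp.linearCombination_single, one_smul]

theorem augmentation_boundary (a : Chains K) : augmentation K (boundary K a) = 0 := by
  suffices h : augmentation K ∘ₗ boundary K = 0 from LinearMap.congr_fun h a
  apply chains_hom_ext
  intro s hs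
  rw [LinearMap.comp_apply, boundary_chain hs, map_sum, LinearMap.zero_apply]
  by_cases hcard : s.card = 2
  · obtain ⟨x, y, hxy, rfl⟩ := Finset.card_eq_two.1 hcard
    have hmem : ∀ z ∈ ({x, y} : Finset V), {z} ∈ K.faces := fun z hz =>
      mem_faces_of_subset hs (Finset.singleton_subset_iff.2 hz) (Finset.singleton_nonempty _)
    have ex : ({x, y} : Finset V).erase x = {y} := by ext; grind
    have ey : ({x, y} : Finset V).erase y = {x} := by ext; grind
    rw [Finset.sum_pair hxy, ex, ey, map_zsmul, map_zsmul, augmentation_chain (hmem x (by simp)),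
      augmentation_chain (hmem y (by simp))]
    rcases lt_or_gt_of_ne hxy with h | h <;>
      simp [below, Finset.filter_insert, Finset.filter_singleton, h, h.not_gt]
  · apply Finset.sum_eq_zero
    intro v hv
    rw [map_zsmul]
    by_cases h : s.erase v ∈ K.faces
    · rw [augmentation_chain h, if_neg, smul_zero]
      rw [Finset.card_erase_of_mem hv]; omega
    · rw [chain_of_notMem h, map_zero, smul_zero]

theorem projection_boundary_projection (σ : Finset V) (a : Chains K) :
    projection K σ (boundary K (projection K σ a)) = boundary K (projection K σ a) := by
  suffices h : projection K σ ∘ₗ boundary K ∘ₗ projection K σ = boundary K ∘ₗ projection K σ from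
    LinearMap.congr_fun h a
  apply chains_hom_ext
  intro s hs
  simp only [LinearMap.comp_apply]
  rw [projection_chain hs]
  split_ifs with h
  · rw [boundary_chain hs, map_sum]
    refine Finset.sum_congr rfl fun v _ => ?_
    rw [map_zsmul, projection_chain_of_subset ((Finset.erase_subset _ _).trans h)]
  · simp

/-- The cone contracts the chains on `σ` to its apex. Working inside the simplex `σ` ensures that
all cones are again simplices of the complex. -/
theorem boundary_cone_chain {s σ : Finset V} {w : V} (hσ : σ ∈ K.faces) (hw : w ∈ σ)
    (hs : s ⊆ σ) (hne : s.Nonempty) :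
    boundary K (cone K w (chain K s)) + cone K w (boundary K (chain K s)) =
      chain K s - augmentation K (chain K s) • chain K {w} := by
  have hmem : ∀ t : Finset V, t ⊆ σ → t.Nonempty → t ∈ K.faces := fun t h h' =>
    mem_faces_of_subset hσ h h'
  have hsK := hmem s hs hne
  rw [cone_chain hsK, boundary_chain hsK, augmentation_chain hsK, map_sum]
  by_cases hws : w ∈ s
  · rw [if_pos hws, map_zero, zero_add, Finset.sum_eq_single_of_mem w hws]
    · rw [map_zsmul]
      by_cases hcard : s.card = 1
      · obtain ⟨v, rfl⟩ := Finset.card_eq_one.1 hcard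
        rw [Finset.mem_singleton] at hws
        subst hws
        simp [chain_empty]
      · have hne' : (s.erase w).Nonempty := by
          rw [← Finset.card_pos, Finset.card_erase_of_mem hws]
          have := Finset.card_pos.2 hne
          omega
        rw [cone_chain (hmem _ ((Finset.erase_subset _ _).trans hs) hne'),
          if_neg (Finset.notMem_erase _ _), Finset.insert_erase hws, below_erase_self, smul_smul,
          neg_one_pow_mul_self, if_neg hcard, one_smul, zero_smul, sub_zero]
    · intro v hv hvw
      rw [map_zsmul, cone_chain (hmem _ ((Finset.erase_subset _ _).trans hs)
        ⟨w, Finset.mem_erase.2 ⟨hvw.symm, hws⟩⟩), if_pos (Finset.mem_erase.2 ⟨hvw.symm, hws⟩),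
        smul_zero]
  · rw [if_neg hws, map_zsmul, boundary_chain (hmem _ (Finset.insert_subset hw hs)
      (Finset.insert_nonempty _ _)), Finset.sum_insert hws, Finset.erase_insert hws,
      below_insert_self, smul_add, smul_smul, neg_one_pow_mul_self, one_smul, Finset.smul_sum,
      add_assoc, ← Finset.sum_add_distrib, sub_eq_add_neg, add_right_inj]
    have hsign : ∀ v ∈ s, (-1 : ℤ) ^ below s w * (-1) ^ below (insert w s) v =
        -((-1) ^ below s v * (-1) ^ below (s.erase v) w) := by
      intro v hv
      have h1 := below_insert (Finset.notMem_erase v s) w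
      rw [Finset.insert_erase hv] at h1
      have hvw : v ≠ w := by rintro rfl; exact hws hv
      rw [h1, below_insert hws]
      rcases lt_or_gt_of_ne hvw with h | h <;> simp only [h, h.not_gt, if_true, if_false] <;> ring
    by_cases hcard : s.card = 1
    · obtain ⟨v, rfl⟩ := Finset.card_eq_one.1 hcard
      have hvw : w ≠ v := by simpa using hws
      have h1 := hsign v (by simp)
      have e1 : (insert w {v} : Finset V).erase v = {w} := by ext; grind
      rw [Finset.sum_singleton, e1, smul_smul, h1]
      simp [chain_empty, below, Finset.filter_singleton]
    · rw [if_neg hcard, zero_smul, neg_zero]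
      apply Finset.sum_eq_zero
      intro v hv
      have hne' : (s.erase v).Nonempty := by
        rw [← Finset.card_pos, Finset.card_erase_of_mem hv]
        have := Finset.card_pos.2 hne
        omega
      have hvw : v ≠ w := by rintro rfl; exact hws hv
      have hw' : w ∉ s.erase v := fun h => hws (Finset.mem_of_mem_erase h)
      have e1 : (insert w s).erase v = insert w (s.erase v) :=
        Finset.erase_insert_of_ne hvw.symm
      rw [map_zsmul, cone_chain (hmem _ ((Finset.erase_subset _ _).trans hs) hne'), if_neg hw',
        smul_smul, smul_smul, hsign v hv, e1, neg_smul, neg_add_cancel]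

theorem boundary_cone_projection {σ : Finset V} {w : V} (hσ : σ ∈ K.faces) (hw : w ∈ σ)
    (a : Chains K) :
    boundary K (cone K w (projection K σ a)) = projection K σ a -
      augmentation K (projection K σ a) • chain K {w} - cone K w (boundary K (projection K σ a)) := by
  rw [eq_sub_iff_add_eq]
  suffices h : (boundary K ∘ₗ cone K w + cone K w ∘ₗ boundary K) ∘ₗ projection K σ =
      (LinearMap.id - (augmentation K).smulRight (chain K {w})) ∘ₗ projection K σ from
    LinearMap.congr_fun h a
  apply chains_hom_ext
  intro s hs
  rw [LinearMap.comp_apply, LinearMap.comp_apply, projection_chain hs]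
  split_ifs with h
  · exact boundary_cone_chain hσ hw h (nonempty_of_mem_faces hs)
  · rw [map_zero, map_zero]

/-- The chain map of the retraction that sends all vertices outside `σ` to `w`. -/
def retraction (K : PreAbstractSimplicialComplex V) (σ : Finset V) (w : V) :
    Chains K →ₗ[ℤ] Chains K :=
  projection K σ + (cone K w ∘ₗ projection K σ ∘ₗ boundary K +
    (augmentation K).smulRight (chain K {w})) ∘ₗ (LinearMap.id - projection K σ)

theorem retraction_apply (σ : Finset V) (w : V) (a : Chains K) :
    retraction K σ w a = projection K σ a +
      (cone K w (projection K σ (boundary K (a - projection K σ a))) +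
        augmentation K (a - projection K σ a) • chain K {w}) := rfl

/-- On a simplex not contained in `σ` the retraction is the cone over the part of its boundary in
`σ`, plus the augmentation times the apex. This description avoids the signs of reordering vertices:
the chain map property follows from the contraction formula together with ∂∂ = 0 and ε∂ = 0. -/
theorem boundary_retraction {σ : Finset V} {w : V} (hσ : σ ∈ K.faces) (hw : w ∈ σ)
    (a : Chains K) : boundary K (retraction K σ w a) = retraction K σ w (boundary K a) := by
  have hW : boundary K (chain K {w}) = 0 := by
    rw [boundary_chain (mem_faces_of_subset hσ (by simpa using hw) (by simp))]
    simp [chain_empty]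
  have h1 : projection K σ (boundary K (a - projection K σ a)) =
      projection K σ (boundary K a) - boundary K (projection K σ a) := by
    rw [map_sub, map_sub, projection_boundary_projection]
  rw [retraction_apply, retraction_apply, map_add, map_add, map_zsmul, hW, smul_zero, add_zero,
    boundary_cone_projection hσ hw, map_sub (boundary K) (boundary K a), boundary_boundary,
    map_sub (augmentation K) (boundary K a), augmentation_boundary, h1, map_sub, map_sub,
    augmentation_boundary, boundary_boundary, zero_sub, zero_sub, sub_zero, sub_zero,
    map_neg, map_neg, projection_boundary_projection, neg_smul]
  abel

theorem retraction_chain_of_subset {s σ : Finset V} (w : V) (h : s ⊆ σ) :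
    retraction K σ w (chain K s) = chain K s := by
  rw [retraction_apply, projection_chain_of_subset h]
  simp

theorem chainCoeff_projection {s σ : Finset V} (a : Chains K)
    (h : chainCoeff K s (projection K σ a) ≠ 0) : s ⊆ σ ∧ chainCoeff K s a ≠ 0 := by
  have : chainCoeff K s (projection K σ a) = if s ⊆ σ then chainCoeff K s a else 0 := by
    suffices h : chainCoeff K s ∘ₗ projection K σ = if s ⊆ σ then chainCoeff K s else 0 by
      have := LinearMap.congr_fun h a
      split_ifs at this ⊢ <;> exact this
    apply chains_hom_ext
    intro t ht
    rw [LinearMap.comp_apply, projection_chain ht]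
    by_cases h1 : t ⊆ σ <;> by_cases h2 : s ⊆ σ <;> by_cases h3 : s = t <;>
      simp_all [chainCoeff_chain]
  rw [this] at h
  split_ifs at h with h'
  · exact ⟨h', h⟩
  · exact absurd rfl h

theorem chainCoeff_cone {s : Finset V} {w : V} (a : Chains K)
    (h : chainCoeff K s (cone K w a) ≠ 0) : w ∈ s ∧ chainCoeff K (s.erase w) a ≠ 0 := by
  classical
  by_contra hcon
  apply h
  have : chainCoeff K s (cone K w a) =
      if w ∈ s then (-1) ^ below s w * chainCoeff K (s.erase w) a else 0 := by
    suffices h : chainCoeff K s ∘ₗ cone K w =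
        if w ∈ s then (-1 : ℤ) ^ below s w • chainCoeff K (s.erase w) else 0 by
      have := LinearMap.congr_fun h a
      split_ifs at this ⊢ <;> exact this
    apply chains_hom_ext
    intro t ht
    rw [LinearMap.comp_apply, cone_chain ht]
    by_cases hws : w ∈ s
    · rw [if_pos hws, LinearMap.smul_apply, chainCoeff_chain]
      by_cases hst : s.erase w = t
      · subst hst
        rw [if_neg (Finset.notMem_erase _ _), map_zsmul, Finset.insert_erase hws, below_erase_self]
        by_cases hs : s ∈ K.faces
        · rw [chainCoeff_chain, if_pos ⟨rfl, hs⟩, if_pos ⟨rfl, ht⟩]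
        · rw [chainCoeff_of_notMem hs] at h
          exact absurd rfl h
      · rw [if_neg (c := s.erase w = t ∧ _) fun h' => hst h'.1, smul_zero]
        split_ifs with hwt
        · exact map_zero _
        · rw [map_zsmul, chainCoeff_chain, if_neg, smul_zero]
          rintro ⟨rfl, -⟩
          exact hst (Finset.erase_insert hwt)
    · rw [if_neg hws, LinearMap.zero_apply]
      split_ifs with hwt
      · exact map_zero _
      · rw [map_zsmul, chainCoeff_chain, if_neg, smul_zero]
        rintro ⟨rfl, -⟩
        exact hws (Finset.mem_insert_self _ _)
  rw [this]
  split_ifs with hw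
  · rw [not_and, not_not] at hcon
    rw [hcon hw, mul_zero]
  · rfl

/-- The retraction of the vertices. -/
def vertexRetraction (σ : Finset V) (w v : V) : V := if v ∈ σ then v else w

/-- Identifies the retraction with the map induced by `vertexRetraction`: a simplex can survive only
if the vertex map is injective on it. This cardinality condition is what the counting argument for
locality uses. -/
theorem chainCoeff_retraction {s t σ : Finset V} {w : V} (hs : s ∈ K.faces) (hw : w ∈ σ)
    (h : chainCoeff K t (retraction K σ w (chain K s)) ≠ 0) :
    t ⊆ σ ∧ t = s.image (vertexRetraction σ w) ∧ t.card = s.card := by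
  classical
  by_cases hsσ : s ⊆ σ
  · rw [retraction_chain_of_subset w hsσ, chainCoeff_chain] at h
    have h' : t = s := by
      by_contra h'
      exact h (if_neg fun h'' => h' h''.1)
    subst h'
    refine ⟨hsσ, ?_, rfl⟩
    rw [Finset.image_congr (g := id), Finset.image_id]
    intro v hv
    exact if_pos (hsσ hv)
  · rw [retraction_apply, projection_chain hs, if_neg hsσ, zero_add, sub_zero, map_add] at h
    by_cases h1 : chainCoeff K t (cone K w (projection K σ (boundary K (chain K s)))) = 0
    · rw [h1, zero_add, map_zsmul, augmentation_chain hs, chainCoeff_chain] at h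
      by_cases hcard : s.card = 1
      · obtain ⟨v, rfl⟩ := Finset.card_eq_one.1 hcard
        have ht : t = {w} := by
          by_contra h'
          exact h (by rw [if_neg (c := t = {w} ∧ _) fun h'' => h' h''.1, smul_zero])
        subst ht
        have hv : v ∉ σ := by simpa using hsσ
        simp [hw, vertexRetraction, hv]
      · rw [if_neg hcard, zero_smul] at h
        exact absurd rfl h
    · obtain ⟨h2, h3⟩ := chainCoeff_cone _ h1
      obtain ⟨h4, h5⟩ := chainCoeff_projection _ h3
      rw [boundary_chain hs, map_sum] at h5
      obtain ⟨v, hv, h6⟩ := Finset.exists_ne_zero_of_sum_ne_zero h5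
      rw [map_zsmul, chainCoeff_chain] at h6
      have h7 : t.erase w = s.erase v := by
        by_contra h'
        exact h6 (by rw [if_neg fun h'' => h' h''.1, smul_zero])
      have hvσ : v ∉ σ := by
        intro hvσ
        apply hsσ
        rw [← Finset.insert_erase hv, ← h7]
        exact Finset.insert_subset hvσ h4
      have ht : t = insert w (s.erase v) := by rw [← h7, Finset.insert_erase h2]
      refine ⟨?_, ?_, ?_⟩
      · rw [ht, ← h7]; exact Finset.insert_subset hw h4
      · rw [← Finset.insert_erase hv, Finset.image_insert, vertexRetraction, if_neg hvσ, ht]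
        congr 1
        rw [Finset.image_congr (g := id), Finset.image_id]
        intro u hu
        rw [← h7] at hu
        exact if_pos (h4 hu)
      · rw [← Finset.insert_erase h2, h7, Finset.card_insert_of_notMem, Finset.card_erase_add_one hv]
        rw [← h7]; exact Finset.notMem_erase _ _

theorem signMap_retraction {σ : Finset V} {w : V} (hw : w ∈ σ) (a : Chains K) :
    signMap K (retraction K σ w a) = retraction K σ w (signMap K a) := by
  suffices h : signMap K ∘ₗ retraction K σ w = retraction K σ w ∘ₗ signMap K from
    LinearMap.congr_fun h a
  apply chains_hom_ext
  intro s hs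
  rw [LinearMap.comp_apply, LinearMap.comp_apply, signMap_chain, map_zsmul]
  apply chain_ext
  intro t ht
  rw [chainCoeff_signMap, map_zsmul, smul_eq_mul]
  by_cases h : chainCoeff K t (retraction K σ w (chain K s)) = 0
  · rw [h, mul_zero, mul_zero]
  · rw [(chainCoeff_retraction hs hw h).2.2]

end

section

variable {V : Type*} [LinearOrder V] [Fintype V] {K : PreAbstractSimplicialComplex V}

/-! ### Locality of solutions with few terms -/

theorem tensor_eq_sum_terms (z : Chains K ⊗[ℤ] Chains K) :
    z = ∑ p ∈ terms z, tensorCoeff K p.1.1 p.2.1 z • (chain K p.1.1 ⊗ₜ[ℤ] chain K p.2.1) := by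
  classical
  apply tensor_ext
  intro X hX Y hY
  have hterm : ∀ p ∈ terms z, tensorCoeff K X Y
      (tensorCoeff K p.1.1 p.2.1 z • (chain K p.1.1 ⊗ₜ[ℤ] chain K p.2.1)) =
      if p = (⟨X, hX⟩, ⟨Y, hY⟩) then tensorCoeff K X Y z else 0 := by
    intro p _
    rw [map_zsmul, tensorCoeff_tmul, chainCoeff_chain, chainCoeff_chain]
    have hp1 := p.1.2
    have hp2 := p.2.2
    by_cases h : p = (⟨X, hX⟩, ⟨Y, hY⟩)
    · subst h
      simp [hX, hY]
    · rw [if_neg h]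
      have : ¬ (X = p.1.1 ∧ Y = p.2.1) := by
        rintro ⟨rfl, rfl⟩
        exact h rfl
      rw [not_and_or] at this
      rcases this with h' | h' <;> simp [h']
  rw [map_sum, Finset.sum_congr rfl hterm, Finset.sum_ite_eq']
  split_ifs with h
  · rfl
  · rw [mem_terms, not_not] at h
    exact h

/-- The retraction of the tensor square. -/
def tensorRetraction (K : PreAbstractSimplicialComplex V) (σ : Finset V) (w : V) :
    Chains K ⊗[ℤ] Chains K →+ Chains K ⊗[ℤ] Chains K :=
  (TensorProduct.map (retraction K σ w) (retraction K σ w)).toAddMonoidHom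

theorem tensorRetraction_tmul (σ : Finset V) (w : V) (a b : Chains K) :
    tensorRetraction K σ w (a ⊗ₜ[ℤ] b) = retraction K σ w a ⊗ₜ[ℤ] retraction K σ w b := rfl

theorem tensorBoundary_tensorRetraction {σ : Finset V} {w : V} (hσ : σ ∈ K.faces) (hw : w ∈ σ)
    (z : Chains K ⊗[ℤ] Chains K) : tensorBoundary K (tensorRetraction K σ w z) =
      tensorRetraction K σ w (tensorBoundary K z) := by
  induction z using TensorProduct.induction_on with
  | zero => simp
  | tmul a b =>
    rw [tensorRetraction_tmul, tensorBoundary_tmul, tensorBoundary_tmul, map_add,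
      tensorRetraction_tmul, tensorRetraction_tmul, boundary_retraction hσ hw,
      boundary_retraction hσ hw, signMap_retraction hw]
  | add z z' hz hz' => rw [map_add, map_add, hz, hz', map_add, map_add]

theorem tensorRetraction_eq_self {σ : Finset V} {w : V} {z : Chains K ⊗[ℤ] Chains K}
    (h : ∀ X Y, tensorCoeff K X Y z ≠ 0 → X ⊆ σ ∧ Y ⊆ σ) : tensorRetraction K σ w z = z := by
  conv_lhs => rw [tensor_eq_sum_terms z]
  conv_rhs => rw [tensor_eq_sum_terms z]
  rw [map_sum]
  refine Finset.sum_congr rfl fun p hp => ?_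
  have := h _ _ (mem_terms.1 hp)
  rw [map_zsmul, tensorRetraction_tmul, retraction_chain_of_subset w this.1,
    retraction_chain_of_subset w this.2]

theorem exists_term_of_tensorRetraction {σ X Y : Finset V} {w : V} {z : Chains K ⊗[ℤ] Chains K}
    (hw : w ∈ σ) (h : tensorCoeff K X Y (tensorRetraction K σ w z) ≠ 0) :
    (X ⊆ σ ∧ Y ⊆ σ) ∧ ∃ p ∈ terms z,
      (X = p.1.1.image (vertexRetraction σ w) ∧ X.card = p.1.1.card) ∧
      (Y = p.2.1.image (vertexRetraction σ w) ∧ Y.card = p.2.1.card) := by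
  rw [tensor_eq_sum_terms z, map_sum, map_sum] at h
  obtain ⟨p, hp, h1⟩ := Finset.exists_ne_zero_of_sum_ne_zero h
  rw [map_zsmul, map_zsmul, tensorRetraction_tmul, tensorCoeff_tmul, smul_eq_mul] at h1
  have h2 := right_ne_zero_of_mul h1
  have h3 := chainCoeff_retraction p.1.2 hw (left_ne_zero_of_mul h2)
  have h4 := chainCoeff_retraction p.2.2 hw (right_ne_zero_of_mul h2)
  exact ⟨⟨h3.1, h4.1⟩, p, hp, h3.2, h4.2⟩

/-- The composition of a map to the tensor square with the retraction onto `σ`. -/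
def retract (D : Chains K →ₗ[ℤ] Chains K ⊗[ℤ] Chains K) (σ : Finset V) (w : V) :
    Chains K →ₗ[ℤ] Chains K ⊗[ℤ] Chains K :=
  ((tensorRetraction K σ w).comp D.toAddMonoidHom).toIntLinearMap

theorem retract_apply (D : Chains K →ₗ[ℤ] Chains K ⊗[ℤ] Chains K) (σ : Finset V) (w : V)
    (a : Chains K) : retract D σ w a = tensorRetraction K σ w (D a) := rfl

theorem model_subset {k : ℕ} {U : Set (Finset V)} {τ X Y : Finset V} (h : model k U τ X Y ≠ 0) :
    X ⊆ τ ∧ Y ⊆ τ := by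
  rw [← (model_ne_zero h).1]
  exact ⟨Finset.subset_union_left, Finset.subset_union_right⟩

/-- The retraction is a chain map fixing the chains on `σ`, and the right-hand side is already
supported on faces of `τ ⊆ σ`. -/
theorem homotopyFormulaAt_retract {i : ℕ} {D : Chains K →ₗ[ℤ] Chains K ⊗[ℤ] Chains K}
    {σ τ : Finset V} {w : V} (hσ : σ ∈ K.faces) (hw : w ∈ σ) (hτ : τ ∈ K.faces) (hτσ : τ ⊆ σ)
    (h : HomotopyFormulaAt K i D τ) : HomotopyFormulaAt K i (retract D σ w) τ := by
  rw [HomotopyFormulaAt, retract_apply, retract_apply, tensorBoundary_tensorRetraction hσ hw,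
    ← map_zsmul, ← map_sub, h]
  apply tensorRetraction_eq_self
  intro X Y hXY
  by_cases hf : X ∈ K.faces ∧ Y ∈ K.faces
  · have e1 := mapCoeff_prevCoproduct (i := i) hτ hf.1 hf.2
    have e2 := mapCoeff_prevCoproduct (i := i) hτ hf.2 hf.1
    simp only [mapCoeff] at e1 e2
    rw [map_add, map_zsmul, tensorCoeff_swap, e1, e2] at hXY
    by_cases h1 : model i ∅ τ X Y = 0
    · by_cases h2 : model i ∅ τ Y X = 0
      · simp [h1, h2] at hXY
      · have := model_subset h2
        exact ⟨this.2.trans hτσ, this.1.trans hτσ⟩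
    · have := model_subset h1
      exact ⟨this.1.trans hτσ, this.2.trans hτσ⟩
  · exact absurd (tensorCoeff_of_notMem hf _) hXY

theorem isLocalSolution_of_subset {i : ℕ} {D : Chains K →ₗ[ℤ] Chains K ⊗[ℤ] Chains K}
    {σ : Finset V} (hσ : σ ∈ K.faces) (hD : ∀ τ ∈ K.faces, τ ⊆ σ → HomotopyFormulaAt K i D τ)
    (hnorm : i = 0 → ∀ v ∈ σ, D (chain K {v}) = chain K {v} ⊗ₜ[ℤ] chain K {v})
    (hloc : ∀ τ ⊆ σ, ∀ X Y, mapCoeff D τ X Y ≠ 0 → X ⊆ τ ∧ Y ⊆ τ) :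
    IsLocalSolution (mapCoeff D) i σ where
  subset := hloc
  nonempty := fun _ _ _ h =>
    ⟨nonempty_of_mem_faces (mapCoeff_ne_zero h).2.1, nonempty_of_mem_faces (mapCoeff_ne_zero h).2.2⟩
  formula := fun τ hτ hne X hX hXne Y hY hYne =>
    (homotopyFormulaAt_iff (mem_faces_of_subset hσ hτ hne)).1
      (hD τ (mem_faces_of_subset hσ hτ hne) hτ) X (mem_faces_of_subset hσ (hX.trans hτ) hXne) Y
      (mem_faces_of_subset hσ (hY.trans hτ) hYne)
  normalized := fun hi v hv => by
    have : {v} ∈ K.faces := mem_faces_of_subset hσ (by simpa using hv) (by simp)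
    rw [mapCoeff, hnorm hi v hv, tensorCoeff_tmul, chainCoeff_chain, if_pos ⟨rfl, this⟩, mul_one]

theorem IsLocalSolution.exists_ne_zero {c : Finset V → Finset V → Finset V → ℤ} {i : ℕ}
    {σ L : Finset V} (h : IsLocalSolution c i σ) (hL : L ∈ σ.powersetCard (i + 1)) :
    ∃ X Y, c σ X Y ≠ 0 ∧ X ∪ Y = σ ∧ X ∩ Y = L := by
  rw [Finset.mem_powersetCard] at hL
  have hsub := hL.1
  have hsum := h.sum_cubeCoeff hL.1 hL.2
  obtain ⟨A, hA, hne⟩ := Finset.exists_ne_zero_of_sum_ne_zero (hsum.trans_ne one_ne_zero)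
  rw [Finset.mem_powerset] at hA
  refine ⟨_, _, right_ne_zero_of_mul hne, ?_, union_inter_sdiff_eq hL.1 hA⟩
  ext a; have := @hA a; have := @hsub a; grind

/-- If every label in `S` is the label of a good element of `T`, and `T` is not larger than `S`,
then all elements of `T` are good, and they are determined by their labels. -/
theorem good_and_injOn_of_card_le {α β : Type*} {S : Finset α} {T : Finset β} {label : β → α}
    {good : β → Prop} (h : ∀ a ∈ S, ∃ t ∈ T, good t ∧ label t = a) (hcard : T.card ≤ S.card) :
    (∀ t ∈ T, good t ∧ label t ∈ S) ∧ Set.InjOn label T := by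
  classical
  rcases T.eq_empty_or_nonempty with rfl | ⟨t₀, -⟩
  · simp
  have : Nonempty β := ⟨t₀⟩
  choose! f hfT hgood hlabel using h
  have himage : S.image f = T := by
    apply Finset.eq_of_subset_of_card_le (Finset.image_subset_iff.2 hfT)
    rwa [Finset.card_image_of_injOn]
    intro a ha b hb hab
    rw [← hlabel a ha, ← hlabel b hb, hab]
  constructor
  · intro t ht
    rw [← himage, Finset.mem_image] at ht
    obtain ⟨a, ha, rfl⟩ := ht
    exact ⟨hgood a ha, by rwa [hlabel a ha]⟩
  · intro t ht t' ht' heq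
    rw [Finset.mem_coe, ← himage, Finset.mem_image] at ht ht'
    obtain ⟨a, ha, rfl⟩ := ht
    obtain ⟨b, hb, rfl⟩ := ht'
    rw [hlabel a ha, hlabel b hb] at heq
    rw [heq]

theorem image_vertexRetraction_of_subset {σ X : Finset V} (w : V) (h : X ⊆ σ) :
    X.image (vertexRetraction σ w) = X := by
  rw [Finset.image_congr (g := id), Finset.image_id]
  intro v hv
  exact if_pos (h hv)

/-- If `v` lies outside `σ`, a second vertex `y` would be identified with it: by choosing `w = y` if
`y ∈ σ`, and by any `w` otherwise. -/
theorem eq_singleton_of_card_image_vertexRetraction {σ X : Finset V} (hσ : σ.Nonempty)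
    (hX : ¬ X ⊆ σ) (h : ∀ w ∈ σ, (X.image (vertexRetraction σ w)).card = X.card) :
    ∃ v, v ∉ σ ∧ X = {v} := by
  obtain ⟨v, hv, hvσ⟩ := Finset.not_subset.1 hX
  refine ⟨v, hvσ, Finset.eq_singleton_iff_unique_mem.2 ⟨hv, fun y hy => ?_⟩⟩
  by_cases hyσ : y ∈ σ
  · exact Finset.card_image_iff.1 (h y hyσ) hy hv (by simp [vertexRetraction, hvσ])
  · obtain ⟨w, hw⟩ := hσ
    exact Finset.card_image_iff.1 (h w hw) hy hv (by simp [vertexRetraction, hvσ, hyσ])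

theorem eq_singleton_of_not_subset {i : ℕ} {σ X Y : Finset V} (hσ : σ.Nonempty)
    (hX : ¬ X ⊆ σ) (h : ∀ w ∈ σ, (X.image (vertexRetraction σ w)).card = X.card) {w : V}
    (hcard : (X.image (vertexRetraction σ w) ∩ Y).card = i + 1) :
    X.image (vertexRetraction σ w) ∩ Y = {w} := by
  obtain ⟨v, hv, rfl⟩ := eq_singleton_of_card_image_vertexRetraction hσ hX h
  have hsub : ({v} : Finset V).image (vertexRetraction σ w) ∩ Y ⊆ {w} := by
    rw [Finset.image_singleton, vertexRetraction, if_neg hv]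
    exact Finset.inter_subset_left
  exact Finset.eq_of_subset_of_card_le hsub (by rw [hcard]; simp)

/-- For every `w`, the retracted solution needs a term for each `L`, and each comes from an original
term on which the retraction is injective. The bound on the number of terms makes this
correspondence bijective for every `w` at once, which leaves almost no room for a term outside `σ`.
-/
theorem terms_subset_of_card_le {i : ℕ} {D : Chains K →ₗ[ℤ] Chains K ⊗[ℤ] Chains K}
    {σ : Finset V} (hσ : σ ∈ K.faces) (hD : ∀ τ ∈ K.faces, τ ⊆ σ → HomotopyFormulaAt K i D τ)
    (hnorm : i = 0 → ∀ v ∈ σ, D (chain K {v}) = chain K {v} ⊗ₜ[ℤ] chain K {v})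
    (hcard : (terms (D (chain K σ))).card ≤ σ.card.choose (i + 1))
    (hloc : ∀ τ, τ ⊂ σ → ∀ X Y, mapCoeff D τ X Y ≠ 0 → X ⊆ τ ∧ Y ⊆ τ) :
    ∀ p ∈ terms (D (chain K σ)), p.1.1 ⊆ σ ∧ p.2.1 ⊆ σ := by
  classical
  have hσne := nonempty_of_mem_faces hσ
  have hretract : ∀ w ∈ σ, IsLocalSolution (mapCoeff (retract D σ w)) i σ := by
    intro w hw
    apply isLocalSolution_of_subset hσ
    · intro τ hτ hτσ
      exact homotopyFormulaAt_retract hσ hw hτ hτσ (hD τ hτ hτσ)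
    · intro hi v hv
      rw [retract_apply, hnorm hi v hv, tensorRetraction_tmul,
        retraction_chain_of_subset w (by simpa using hv)]
    · intro τ hτ X Y hXY
      -- On proper faces the map is already local and unchanged by the retraction; on `σ` the
      -- retraction forces locality.
      rcases hτ.eq_or_ssubset with rfl | hτ
      · exact (exists_term_of_tensorRetraction hw hXY).1
      · rw [mapCoeff, retract_apply, tensorRetraction_eq_self] at hXY
        · exact hloc τ hτ X Y hXY
        · intro X' Y' h'
          have := hloc τ hτ X' Y' h'
          exact ⟨this.1.trans hτ.subset, this.2.trans hτ.subset⟩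
  let label : V → K.faces × K.faces → Finset V := fun w p =>
    p.1.1.image (vertexRetraction σ w) ∩ p.2.1.image (vertexRetraction σ w)
  let good : V → K.faces × K.faces → Prop := fun w p =>
    (p.1.1.image (vertexRetraction σ w)).card = p.1.1.card ∧
    (p.2.1.image (vertexRetraction σ w)).card = p.2.1.card
  have hexists : ∀ w ∈ σ, ∀ L ∈ σ.powersetCard (i + 1), ∃ p ∈ terms (D (chain K σ)),
      good w p ∧ label w p = L := by
    intro w hw L hL
    obtain ⟨X, Y, hne, -, hXY⟩ := (hretract w hw).exists_ne_zero hL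
    obtain ⟨-, p, hp, ⟨rfl, h1⟩, rfl, h2⟩ := exists_term_of_tensorRetraction hw hne
    exact ⟨p, hp, ⟨h1, h2⟩, hXY⟩
  have hall := fun w hw => good_and_injOn_of_card_le (hexists w hw)
    (by rwa [Finset.card_powersetCard])
  -- A factor not contained in `σ` is a single outside vertex, which is sent to `w`; so the label
  -- moves with `w`.
  have hnonlocal : ∀ p ∈ terms (D (chain K σ)), ¬ (p.1.1 ⊆ σ ∧ p.2.1 ⊆ σ) →
      ∀ w ∈ σ, label w p = {w} := by
    intro p hp hns w hw
    have hLcard := (Finset.mem_powersetCard.1 ((hall w hw).1 p hp).2).2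
    rw [not_and_or] at hns
    rcases hns with hns | hns
    · exact eq_singleton_of_not_subset hσne hns (fun w' hw' => ((hall w' hw').1 p hp).1.1) hLcard
    · have := eq_singleton_of_not_subset (i := i) hσne hns
        (fun w' hw' => ((hall w' hw').1 p hp).1.2)
        (Y := p.1.1.image (vertexRetraction σ w)) (w := w) (by rw [Finset.inter_comm]; exact hLcard)
      rwa [Finset.inter_comm] at this
  intro p hp
  by_contra hns
  obtain ⟨w, hw⟩ := hσne
  have hpw := hnonlocal p hp hns w hw
  have hi : i = 0 := by
    have := (Finset.mem_powersetCard.1 ((hall w hw).1 p hp).2).2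
    rw [hpw, Finset.card_singleton] at this
    omega
  by_cases hsing : σ = {w}
  · rw [hsing, hnorm hi w hw, mem_terms, tensorCoeff_tmul] at hp
    have h1 := left_ne_zero_of_mul hp
    have h2 := right_ne_zero_of_mul hp
    rw [chainCoeff_chain] at h1 h2
    refine hns ⟨?_, ?_⟩
    · by_contra h'
      exact h1 (if_neg fun h'' => h' (by rw [h''.1, hsing]))
    · by_contra h'
      exact h2 (if_neg fun h'' => h' (by rw [h''.1, hsing]))
  · obtain ⟨w', hw', hww'⟩ : ∃ w' ∈ σ, w' ≠ w := by
      by_contra hcon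
      push Not at hcon
      exact hsing (Finset.eq_singleton_iff_unique_mem.2 ⟨hw, hcon⟩)
    -- The label {w} for the retraction to `w'` must come from some `q`. If `q` lies in `σ`, its
    -- label does not depend on the apex, so injectivity identifies it with `p`; otherwise its label
    -- is {w'}.
    obtain ⟨q, hq, -, hqw⟩ := hexists w' hw' {w} (by simp [Finset.mem_powersetCard, hw, hi])
    by_cases hqs : q.1.1 ⊆ σ ∧ q.2.1 ⊆ σ
    · have hqw2 : label w q = {w} := by
        rw [← hqw]
        simp only [label, image_vertexRetraction_of_subset _ hqs.1,
          image_vertexRetraction_of_subset _ hqs.2]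
      have hpq := (hall w hw).2 hp hq (hpw.trans hqw2.symm)
      exact hns (hpq ▸ hqs)
    · rw [hnonlocal q hq hqs w' hw'] at hqw
      exact hww' (Finset.singleton_injective hqw)

theorem mapCoeff_subset_of_isLocal {D : Chains K →ₗ[ℤ] Chains K ⊗[ℤ] Chains K} (hD : IsLocal D)
    (τ X Y : Finset V) (h : mapCoeff D τ X Y ≠ 0) : X ⊆ τ ∧ Y ⊆ τ := by
  obtain ⟨hτ, hX, hY⟩ := mapCoeff_ne_zero h
  have := hD ⟨τ, hτ⟩ (⟨X, hX⟩, ⟨Y, hY⟩)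
  rw [← chain_coe, mem_terms] at this
  exact this h

/-- Strong induction on the simplex: locality on proper faces is what makes the retracted map a
local solution on all faces. -/
theorem isLocal_of_forall_numTerms_le {i : ℕ} {D : Chains K →ₗ[ℤ] Chains K ⊗[ℤ] Chains K}
    (hD : HomotopyFormula K i D) (hnorm : IsNormalized K i D)
    (hcard : ∀ σ : K.faces, numTerms D σ ≤ σ.1.card.choose (i + 1)) : IsLocal D := by
  rw [homotopyFormula_iff] at hD
  have main : ∀ σ : Finset V, ∀ X Y, mapCoeff D σ X Y ≠ 0 → X ⊆ σ ∧ Y ⊆ σ := by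
    intro σ
    induction σ using Finset.strongInduction with
    | H σ ih =>
    intro X Y hXY
    obtain ⟨hσ, hX, hY⟩ := mapCoeff_ne_zero hXY
    refine terms_subset_of_card_le hσ (fun τ hτ _ => hD τ hτ) ?_ ?_ ih (⟨X, hX⟩, ⟨Y, hY⟩)
      (mem_terms.2 hXY)
    · intro hi v hv
      have hv' : {v} ∈ K.faces := mem_faces_of_subset hσ (by simpa using hv) (by simp)
      rw [chain_of_mem hv']
      exact hnorm hi ⟨{v}, hv'⟩ rfl
    · have := hcard ⟨σ, hσ⟩
      rwa [numTerms, ← chain_coe] at this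
  intro σ p hp
  rw [← chain_coe, mem_terms] at hp
  exact main _ _ _ hp

/-! ### Minimal solutions -/

theorem isLocalSolution_of_isLocal {i : ℕ} {D : Chains K →ₗ[ℤ] Chains K ⊗[ℤ] Chains K}
    (hD : HomotopyFormula K i D) (hnorm : IsNormalized K i D) (hloc : IsLocal D) {σ : Finset V}
    (hσ : σ ∈ K.faces) : IsLocalSolution (mapCoeff D) i σ := by
  rw [homotopyFormula_iff] at hD
  refine isLocalSolution_of_subset hσ (fun τ hτ _ => hD τ hτ) ?_
    fun τ _ => mapCoeff_subset_of_isLocal hloc τ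
  intro hi v hv
  have hv' : {v} ∈ K.faces := mem_faces_of_subset hσ (by simpa using hv) (by simp)
  rw [chain_of_mem hv']
  exact hnorm hi ⟨{v}, hv'⟩ rfl

theorem IsLocalSolution.exists_term {i : ℕ} {D : Chains K →ₗ[ℤ] Chains K ⊗[ℤ] Chains K}
    {σ : K.faces} (h : IsLocalSolution (mapCoeff D) i σ.1) :
    ∀ L ∈ σ.1.powersetCard (i + 1), ∃ p ∈ terms (D (Finsupp.single σ 1)),
      p.1.1 ∪ p.2.1 = σ.1 ∧ p.1.1 ∩ p.2.1 = L := by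
  intro L hL
  obtain ⟨X, Y, hne, h1, h2⟩ := h.exists_ne_zero hL
  obtain ⟨-, hX, hY⟩ := mapCoeff_ne_zero hne
  refine ⟨(⟨X, hX⟩, ⟨Y, hY⟩), ?_, h1, h2⟩
  rw [← chain_coe]
  exact mem_terms.2 hne

theorem choose_le_numTerms {i : ℕ} {D : Chains K →ₗ[ℤ] Chains K ⊗[ℤ] Chains K} {σ : K.faces}
    (h : IsLocalSolution (mapCoeff D) i σ.1) : σ.1.card.choose (i + 1) ≤ numTerms D σ := by
  rw [← Finset.card_powersetCard]
  refine Finset.card_le_card_of_surjOn (fun p => p.1.1 ∩ p.2.1) fun L hL => ?_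
  obtain ⟨p, hp, -, hpL⟩ := h.exists_term L hL
  exact ⟨p, hp, hpL⟩

theorem isMinimalAt_of_numTerms_le {i : ℕ} {D : Chains K →ₗ[ℤ] Chains K ⊗[ℤ] Chains K}
    {σ : K.faces} (h : IsLocalSolution (mapCoeff D) i σ.1)
    (hcard : numTerms D σ ≤ σ.1.card.choose (i + 1)) : IsMinimalAt (mapCoeff D) i σ.1 := by
  rw [← Finset.card_powersetCard] at hcard
  obtain ⟨h1, h2⟩ := good_and_injOn_of_card_le h.exists_term hcard
  have hmem : ∀ X Y, mapCoeff D σ.1 X Y ≠ 0 → ∃ p ∈ terms (D (Finsupp.single σ 1)),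
      p.1.1 = X ∧ p.2.1 = Y := by
    intro X Y hne
    obtain ⟨-, hX, hY⟩ := mapCoeff_ne_zero hne
    refine ⟨(⟨X, hX⟩, ⟨Y, hY⟩), ?_, rfl, rfl⟩
    rw [← chain_coe]
    exact mem_terms.2 hne
  constructor
  · intro X Y hne
    obtain ⟨p, hp, rfl, rfl⟩ := hmem X Y hne
    exact ⟨(h1 p hp).1, (Finset.mem_powersetCard.1 (h1 p hp).2).2⟩
  · intro X Y X' Y' hne hne' heq
    obtain ⟨p, hp, rfl, rfl⟩ := hmem X Y hne
    obtain ⟨q, hq, rfl, rfl⟩ := hmem X' Y' hne'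
    have := h2 hp hq heq
    rw [this]
    exact ⟨rfl, rfl⟩

theorem exists_eq_coproduct {i : ℕ} {D : Chains K →ₗ[ℤ] Chains K ⊗[ℤ] Chains K}
    (hD : HomotopyFormula K i D) (hnorm : IsNormalized K i D) (hloc : IsLocal D)
    (hcard : ∀ σ : K.faces, numTerms D σ ≤ σ.1.card.choose (i + 1)) :
    ∃ U : Set (Finset V), IsConsistent K i U ∧ D = coproduct K i U := by
  have hs : ∀ σ ∈ K.faces, IsLocalSolution (mapCoeff D) i σ := fun σ hσ =>
    isLocalSolution_of_isLocal hD hnorm hloc hσ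
  have hm : ∀ σ ∈ K.faces, ∀ τ ⊆ σ, IsMinimalAt (mapCoeff D) i τ := by
    intro σ hσ τ hτ
    rcases τ.eq_empty_or_nonempty with rfl | hne
    · have h0 : ∀ X Y, mapCoeff D ∅ X Y = 0 := fun X Y => by
        by_contra h
        exact (nonempty_of_mem_faces (mapCoeff_ne_zero h).1).ne_empty rfl
      exact ⟨fun X Y h => absurd (h0 X Y) h, fun X Y _ _ h => absurd (h0 X Y) h⟩
    · have hτ' := mem_faces_of_subset hσ hτ hne
      exact isMinimalAt_of_numTerms_le (σ := ⟨τ, hτ'⟩) (hs τ hτ') (hcard ⟨τ, hτ'⟩)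
  have hF : ∀ σ ∈ K.faces, ∀ M ⊆ σ, M.Nonempty → M ∈ K.faces := fun σ hσ M hM hne =>
    mem_faces_of_subset hσ hM hne
  -- The family of faces is built into the inversion set because consistency also requires its
  -- members to be simplices of the complex.
  refine ⟨inversionSet (mapCoeff D) K.faces i, ⟨fun s hs' => ⟨hs'.1, hs'.2.1⟩, ?_⟩, ?_⟩
  · intro M hM hMcard
    exact consistentAt_inversionSet (hF M hM) (hs M hM) (hm M hM) hMcard
  · apply mapCoeff_ext
    intro τ hτ X hX Y hY
    rw [mapCoeff_coproduct hτ hX hY]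
    exact coeff_eq_model (hF τ hτ) (hs τ hτ) (hm τ hτ) X Y

theorem isConsistent_empty (K : PreAbstractSimplicialComplex V) (i : ℕ) : IsConsistent K i ∅ :=
  ⟨fun _ h => h.elim, fun _ _ _ => Or.inl fun _ _ _ _ _ h => h.elim⟩

theorem isLocal_coproduct (i : ℕ) (U : Set (Finset V)) : IsLocal (coproduct K i U) := by
  intro σ p hp
  rw [← chain_coe, mem_terms] at hp
  exact model_subset ((mapCoeff_coproduct σ.2 p.1.2 p.2.2).symm.trans_ne hp)

theorem isNormalized_coproduct_empty (i : ℕ) : IsNormalized K i (coproduct K i ∅) := by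
  classical
  rintro rfl σ hdim
  have hpos := Finset.card_pos.2 (nonempty_of_mem_faces σ.2)
  obtain ⟨v, hv⟩ := Finset.card_eq_one.1 (show σ.1.card = 1 by rw [dim] at hdim; omega)
  rw [← chain_coe]
  apply tensor_ext
  intro X hX Y hY
  have h1 := mapCoeff_coproduct (i := 0) (U := ∅) σ.2 hX hY
  rw [mapCoeff] at h1
  rw [h1, tensorCoeff_tmul, chainCoeff_chain, chainCoeff_chain]
  have hne : ∀ Z ∈ K.faces, Z ⊆ σ.1 → Z = σ.1 := by
    intro Z hZ hZσ
    rw [hv] at hZσ ⊢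
    exact (Finset.subset_singleton_iff.1 hZσ).resolve_left (nonempty_of_mem_faces hZ).ne_empty
  by_cases h : X = σ.1 ∧ Y = σ.1
  · rw [if_pos ⟨h.1, σ.2⟩, if_pos ⟨h.2, σ.2⟩, h.1, h.2, model, if_pos]
    · simp [hv, signExp, Finset.filter_singleton]
    · refine ⟨by simp, by simp [hv], ?_⟩
      rw [Finset.sdiff_self, Finset.inter_self]
      ext a
      simp only [mem_initVertex]
      tauto
  · have h0 : model (0 + 1) ∅ σ.1 X Y = 0 := by
      by_contra h0
      exact h ⟨hne X hX (model_subset h0).1, hne Y hY (model_subset h0).2⟩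
    rw [h0]
    rw [not_and_or] at h
    rcases h with h | h <;> simp [h]

theorem numTerms_coproduct_le {i : ℕ} {U : Set (Finset V)} (σ : K.faces) :
    numTerms (coproduct K i U) σ ≤ σ.1.card.choose (i + 1) := by
  rw [← Finset.card_powersetCard, numTerms]
  have hterm : ∀ p ∈ terms (coproduct K i U (Finsupp.single σ 1)),
      model (i + 1) U σ.1 p.1.1 p.2.1 ≠ 0 := by
    intro p hp
    rw [← chain_coe, mem_terms] at hp
    exact (mapCoeff_coproduct σ.2 p.1.2 p.2.2).symm.trans_ne hp
  refine Finset.card_le_card_of_injOn (fun p => p.1.1 ∩ p.2.1) ?_ ?_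
  · intro p hp
    have hne := hterm p hp
    exact Finset.mem_powersetCard.2
      ⟨Finset.inter_subset_left.trans (model_subset hne).1, (model_ne_zero hne).2.1⟩
  · intro p hp q hq hpq
    have hp' := model_ne_zero (hterm p hp)
    have hq' := model_ne_zero (hterm q hq)
    dsimp only at hpq
    have h1 : p.1.1 \ p.2.1 = q.1.1 \ q.2.1 := by rw [hp'.2.2, hq'.2.2, hpq]
    have h2 := hp'.1.trans hq'.1.symm
    have e1 : p.1.1 = q.1.1 := by
      rw [← Finset.sdiff_union_inter p.1.1 p.2.1, h1, hpq, Finset.sdiff_union_inter]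
    have e2 : p.2.1 = q.2.1 := by
      ext a
      have b1 := Finset.ext_iff.1 hpq a
      have b2 := Finset.ext_iff.1 h2 a
      rw [e1] at b1 b2
      simp only [Finset.mem_inter, Finset.mem_union] at b1 b2
      tauto
    exact Prod.ext (Subtype.ext e1) (Subtype.ext e2)

end

end CupCoproduct

end

/-! ### Comparison with Δ_i^∅ -/

theorem theorem4p5 (n i : ℕ) (K : PreAbstractSimplicialComplex (Fin (n + 1))) :
    -- every consistent set gives a solution of the homotopy formula
    (∀ U : Set (Finset (Fin (n + 1))), CupCoproduct.IsConsistent K i U →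
      CupCoproduct.HomotopyFormula K i (CupCoproduct.coproduct K i U)) ∧
    -- converse, with the number of terms minimal on every simplex
    (∀ D : CupCoproduct.Chains K →ₗ[ℤ]
        TensorProduct ℤ (CupCoproduct.Chains K) (CupCoproduct.Chains K),
      CupCoproduct.HomotopyFormula K i D →
      CupCoproduct.IsNormalized K i D →
      (∀ D' : CupCoproduct.Chains K →ₗ[ℤ]
          TensorProduct ℤ (CupCoproduct.Chains K) (CupCoproduct.Chains K),
        CupCoproduct.HomotopyFormula K i D' → CupCoproduct.IsNormalized K i D' →
        CupCoproduct.IsLocal D' →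
        ∀ σ : K.faces, CupCoproduct.numTerms D σ ≤ CupCoproduct.numTerms D' σ) →
      ∃ U : Set (Finset (Fin (n + 1))),
        CupCoproduct.IsConsistent K i U ∧ D = CupCoproduct.coproduct K i U) ∧
    -- converse, with the total number of terms minimal
    (∀ D : CupCoproduct.Chains K →ₗ[ℤ]
        TensorProduct ℤ (CupCoproduct.Chains K) (CupCoproduct.Chains K),
      CupCoproduct.HomotopyFormula K i D →
      CupCoproduct.IsNormalized K i D →
      CupCoproduct.IsLocal D →
      (∀ D' : CupCoproduct.Chains K →ₗ[ℤ]
          TensorProduct ℤ (CupCoproduct.Chains K) (CupCoproduct.Chains K),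
        CupCoproduct.HomotopyFormula K i D' → CupCoproduct.IsNormalized K i D' →
        CupCoproduct.IsLocal D' →
        CupCoproduct.totalTerms D ≤ CupCoproduct.totalTerms D') →
      ∃ U : Set (Finset (Fin (n + 1))),
        CupCoproduct.IsConsistent K i U ∧ D = CupCoproduct.coproduct K i U) := by
  have hform := CupCoproduct.homotopyFormula_coproduct (CupCoproduct.isConsistent_empty K i)
  have hnorm := CupCoproduct.isNormalized_coproduct_empty (K := K) i
  have hloc := CupCoproduct.isLocal_coproduct (K := K) i ∅
  refine ⟨fun U hU => CupCoproduct.homotopyFormula_coproduct hU, ?_, ?_⟩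
  · intro D hD hDn hmin
    have hcard : ∀ σ : K.faces, CupCoproduct.numTerms D σ ≤ σ.1.card.choose (i + 1) := fun σ =>
      (hmin _ hform hnorm hloc σ).trans (CupCoproduct.numTerms_coproduct_le σ)
    exact CupCoproduct.exists_eq_coproduct hD hDn
      (CupCoproduct.isLocal_of_forall_numTerms_le hD hDn hcard) hcard
  · intro D hD hDn hDl hmin
    classical
    refine CupCoproduct.exists_eq_coproduct hD hDn hDl fun σ => ?_
    -- Δ_i^∅ has at most as many terms as `D` on every simplex, by the binomial bound. One simplex
    -- with an excess would make the total of `D` strictly larger.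
    by_contra hlt
    have htotal := hmin _ hform hnorm hloc
    rw [CupCoproduct.totalTerms, CupCoproduct.totalTerms] at htotal
    refine absurd htotal (not_le.2 (Finset.sum_lt_sum (fun τ _ => ?_) ⟨σ, Finset.mem_univ _, ?_⟩))
    · exact (CupCoproduct.numTerms_coproduct_le τ).trans (CupCoproduct.choose_le_numTerms
        (CupCoproduct.isLocalSolution_of_isLocal hD hDn hDl τ.2))
    · exact (CupCoproduct.numTerms_coproduct_le σ).trans_lt (not_le.1 hlt)
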